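/- Let $\Gamma$ be a countable group acting by automorphisms (inversions are allowed) on a tree $\mathcal T$. Assume that the action is faithful; minimal, i.e. $\mathcal T$ has no $\Gamma$-invariant subtree other than $\mathcal T$ itself (subtrees are non-empty); and of general type, i.e. there are two elements of $\Gamma$ which act as hyperbolic automorphisms (non-trivial translations along a bi-infinite geodesic path) and have no common fixed point in the boundary $\partial\mathcal T$ (the set of geodesic rays, where two rays are identified if their ranges differ by a finite set). Suppose that there are a bounded subtree $\mathcal B$ of $\mathcal T$ and a vertex $u$ of $\mathcal B$ such that the pointwise stabilizer $\Gamma_{\mathcal B}$ of $\mathcal B$ is core-free in the stabilizer $\Gamma_u$ of $u$, i.e. $\bigcap_{g\in\Gamma_u} g\,\Gamma_{\mathcal B}\,g^{-1}=\{1\}$. Then $\Gamma$ admits an action on an infinite countable set $X$ which is both highly transitive (for every $k\ge 1$ and all $k$-tuples $(x_1,\dots,x_k)$, $(y_1,\dots,y_k)$ of pairwise distinct points of $X$, some element of $\Gamma$ maps $x_i$ to $y_i$ for all $i$) and highly faithful (for every finite subset $F\subseteq\Gamma\setminus\{1\}$, the intersection over $g\in F$ of the supports $\{x\in X : gx\neq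 x\}$ is infinite). In particular, $\Gamma$ is highly transitive, i.e. it admits a faithful highly transitive action on an infinite countable set. -/

import Mathlib

namespace TreeAction

universe u v w

section Graphs

open scoped symmDiff

variable {V : Type v} {G : SimpleGraph V}

theorem dist_map_le (hG : G.Connected) (φ : G ≃g G) (a b : V) :
    G.dist (φ a) (φ b) ≤ G.dist a b := by
  obtain ⟨p, hp⟩ := hG.exists_walk_length_eq_dist a b
  have h := SimpleGraph.dist_le (p.map φ.toHom)
  rw [SimpleGraph.Walk.length_map, hp] at h
  exact h

theorem dist_map (hG : G.Connected) (φ : G ≃g G) (a b : V) :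
    G.dist (φ a) (φ b) = G.dist a b := by
  refine le_antisymm (dist_map_le hG φ a b) ?_
  have h := dist_map_le hG φ.symm (φ a) (φ b)
  simpa using h

/-- A geodesic ray, given by its sequence of vertices. -/
def IsGeodesicRay (G : SimpleGraph V) (ω : ℕ → V) : Prop :=
  ∀ i n : ℕ, G.dist (ω i) (ω (i + n)) = n

/-- A bi-infinite geodesic path, given by its sequence of vertices. -/
def IsGeodesicLine (G : SimpleGraph V) (ℓ : ℤ → V) : Prop :=
  ∀ (i : ℤ) (n : ℕ), G.dist (ℓ i) (ℓ (i + n)) = n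

/-- The type of geodesic rays of a graph. -/
def GeodesicRay (G : SimpleGraph V) : Type v :=
  {ω : ℕ → V // IsGeodesicRay G ω}

/-- Two geodesic rays are equivalent if their ranges differ by a finite set. -/
def rayRel (ω ω' : GeodesicRay G) : Prop :=
  (Set.range ω.1 ∆ Set.range ω'.1).Finite

theorem rayRel_equivalence : Equivalence (rayRel (G := G)) where
  refl ω := by simp [rayRel]
  symm {ω ω'} h := by
    unfold rayRel at h ⊢
    rwa [symmDiff_comm]
  trans {ω₁ ω₂ ω₃} h h' :=
    (h.union h').subset (symmDiff_triangle (Set.range ω₁.1) (Set.range ω₂.1) (Set.range ω₃.1))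

instance raySetoid (G : SimpleGraph V) : Setoid (GeodesicRay G) :=
  ⟨rayRel, rayRel_equivalence⟩

/-- The boundary (set of ends) of a tree: geodesic rays up to equivalence. -/
def Boundary (T : SimpleGraph V) : Type v :=
  Quotient (raySetoid T)

/-- The image of a geodesic ray by an automorphism of a connected graph. -/
def mapRay (hG : G.Connected) (φ : G ≃g G) (ω : GeodesicRay G) : GeodesicRay G :=
  ⟨fun n => φ (ω.1 n), fun i n => (dist_map hG φ _ _).trans (ω.2 i n)⟩

/-- The map induced on the boundary of a tree by an automorphism of the tree. -/
def boundaryMap {T : SimpleGraph V} (hT : T.IsTree) (φ : T ≃g T) : Boundary T → Boundary T :=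
  Quotient.map (mapRay hT.connected φ) (by
    intro ω ω' h
    change (Set.range (fun n => φ (ω.1 n)) ∆ Set.range (fun n => φ (ω'.1 n))).Finite
    change (Set.range ω.1 ∆ Set.range ω'.1).Finite at h
    have h1 : Set.range (fun n => φ (ω.1 n)) = φ '' Set.range ω.1 := Set.range_comp φ ω.1
    have h2 : Set.range (fun n => φ (ω'.1 n)) = φ '' Set.range ω'.1 := Set.range_comp φ ω'.1
    rw [h1, h2, ← Set.image_symmDiff φ.injective]
    exact h.image φ)

/-- An automorphism is hyperbolic if it acts by a non-trivial translation on some bi-infinite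
geodesic path. -/
def IsHyperbolic {T : SimpleGraph V} (φ : T ≃g T) : Prop :=
  ∃ ℓ : ℤ → V, IsGeodesicLine T ℓ ∧ ∃ n : ℤ, n ≠ 0 ∧ ∀ k : ℤ, φ (ℓ k) = ℓ (k + n)

/-- A subtree is a subgraph which is itself a tree (in particular it is non-empty). -/
def IsSubtree {T : SimpleGraph V} (S : T.Subgraph) : Prop :=
  S.coe.IsTree

/-- A subgraph is bounded if the distances between its vertices are uniformly bounded. -/
def IsBounded {T : SimpleGraph V} (S : T.Subgraph) : Prop :=
  ∃ N : ℕ, ∀ v ∈ S.verts, ∀ w ∈ S.verts, T.dist v w ≤ N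

end Graphs

section Actions

variable {Γ : Type u} [Group Γ] {V : Type v} {T : SimpleGraph V}

/-- The action has no invariant subtree other than the whole tree. -/
def IsMinimal (ρ : Γ →* (T ≃g T)) : Prop :=
  ∀ S : T.Subgraph, IsSubtree S → (∀ g : Γ, S.map (ρ g).toHom = S) → S = ⊤

/-- The action is of general type: there are two hyperbolic elements with no common fixed point
in the boundary. -/
def IsGeneralType (hT : T.IsTree) (ρ : Γ →* (T ≃g T)) : Prop :=
  ∃ g h : Γ, IsHyperbolic (ρ g) ∧ IsHyperbolic (ρ h) ∧
    ∀ ξ : Boundary T, ¬ (boundaryMap hT (ρ g) ξ = ξ ∧ boundaryMap hT (ρ h) ξ = ξ)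

/-- The stabilizer of a vertex. -/
def vertexStabilizer (ρ : Γ →* (T ≃g T)) (u : V) : Subgroup Γ :=
  (MulAction.stabilizer (T ≃g T) u).comap ρ

/-- The pointwise stabilizer of a subgraph. Fixing all its vertices also fixes all its edges. -/
def pointwiseStabilizer (ρ : Γ →* (T ≃g T)) (S : T.Subgraph) : Subgroup Γ :=
  (fixingSubgroup (T ≃g T) S.verts).comap ρ

end Actions

/-- `H` is core-free in `K`, for `H ≤ K`: the intersection of the `K`-conjugates of `H`
is trivial. -/
def IsCoreFreeIn {Γ : Type u} [Group Γ] (H K : Subgroup Γ) : Prop :=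
  H ≤ K ∧ (H.subgroupOf K).normalCore = ⊥

/-- An action is highly transitive if it is `k`-transitive for all `k`. -/
def IsHighlyTransitiveAction (Γ : Type u) (X : Type w) [Group Γ] [MulAction Γ X] : Prop :=
  ∀ k : ℕ, MulAction.IsMultiplyPretransitive Γ X k

/-- An action is highly faithful if the intersection of the supports of finitely many
non-trivial group elements is always infinite. -/
def IsHighlyFaithfulAction (Γ : Type u) (X : Type w) [Group Γ] [MulAction Γ X] : Prop :=
  ∀ F : Finset Γ, 1 ∉ F → {x : X | ∀ g ∈ F, g • x ≠ x}.Infinite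

/-- A group is highly transitive if it has a faithful highly transitive action on some
infinite countable set. -/
def IsHighlyTransitiveGroup (Γ : Type u) [Group Γ] : Prop :=
  ∃ (X : Type) (_ : Countable X) (_ : Infinite X) (_ : MulAction Γ X),
    FaithfulSMul Γ X ∧ IsHighlyTransitiveAction Γ X

end TreeAction

/-!
The action is shown to be topologically free on half-trees, and a subgroup `H` of `Γ` is built for
which the action of `Γ` on `Γ ⧸ H` has the required properties.

*Half-trees.* Removing an edge cuts the tree into two half-trees. Two half-trees are nested up to
complements, only finitely many half-trees lie between two given ones, and, since the action is
minimal and of general type, every half-tree can be moved into any other one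
(`isHalfspaceSystem_halfTrees`). The bounded subtree and the core-free hypothesis give a ball with
trivial pointwise stabilizer (`exists_ball_fixator_trivial`), and since every half-tree contains a
translate of this ball, no non-trivial element acts trivially on a half-tree. All the rest uses only
these properties, collected in `IsHalfspaceSystem`; in particular every `c ≠ 1` displaces some
half-tree inside any given one (`IsHalfspaceSystem.exists_disjoint_smul`).

*The subgroup.* A subgroup `H` is called sparse if every half-tree contains a half-tree `D` such that
the translates `h • D`, for `h ∈ H`, are pairwise disjoint. Let `H` be sparse, and let `a i` and `b i`
be tuples representing distinct cosets of `H`. A small half-tree has disjoint translates under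
`H * S`, for a given finite set `S` (`IsHalfspaceSystem.exists_disjoint_translates`). It follows that
there are small half-trees `U`, `Q` such that the sets `h (a i)⁻¹ U` and `h (b i)⁻¹ Q` are
pairwise disjoint. An element `g` moving the complement of `U` into `Q` has the property that the
elements `(b i)⁻¹ * g * a i` play ping-pong relative to `H`, and together with `H` they generate a
subgroup `H'` such that `g` maps `a i H'` to `b i H'`. The subgroup `H'` is again sparse
(`IsPingPong.isSparse_pingPongGroup`), and it can be made to avoid a finite set of elements outside
of `H` (`IsHalfspaceSystem.exists_sparse_extension`). Starting with the trivial group and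
going through all pairs of tuples, one gets a union `H` such that the action on `Γ ⧸ H` is highly
transitive. For high faithfulness, each finite set `F` of non-trivial elements can be conjugated out
of a sparse subgroup (`IsHalfspaceSystem.exists_forall_conj_notMem`), and the finitely many conjugates
are then kept out of all the later subgroups.
-/

namespace TreeAction

open scoped Pointwise

/-! ### Systems of half-spaces -/

section Halfspaces

variable {Γ : Type*} [Group Γ] {V : Type*} [MulAction Γ V]

/-- A family of half-spaces of `V` on which `Γ` acts by translation: a collection of subsets, closed
under complements and translates, any two of which are nested up to complements, with finite
intervals. The last three fields express that the action is minimal of general type (any half-space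
can be moved into any other one, and there are three pairwise disjoint ones) and faithful on each
half-space. -/
structure IsHalfspaceSystem (Γ : Type*) [Group Γ] {V : Type*} [MulAction Γ V]
    (𝓗 : Set (Set V)) : Prop where
  nonempty : ∀ A ∈ 𝓗, A.Nonempty
  compl_mem : ∀ A ∈ 𝓗, Aᶜ ∈ 𝓗
  smul_mem : ∀ g : Γ, ∀ A ∈ 𝓗, g • A ∈ 𝓗
  nested : ∀ A ∈ 𝓗, ∀ B ∈ 𝓗, Disjoint A B ∨ A ⊆ B ∨ B ⊆ A ∨ Aᶜ ⊆ B
  finite_between : ∀ A ∈ 𝓗, ∀ B ∈ 𝓗, {C | C ∈ 𝓗 ∧ A ⊆ C ∧ C ⊆ B}.Finite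
  exists_smul_subset : ∀ A ∈ 𝓗, ∀ B ∈ 𝓗, ∃ g : Γ, g • A ⊆ B
  exists_facing_triple : ∃ A ∈ 𝓗, ∃ B ∈ 𝓗, ∃ C ∈ 𝓗, Disjoint A B ∧ Disjoint A C ∧ Disjoint B C
  eq_one_of_forall_smul_eq : ∀ U ∈ 𝓗, ∀ c : Γ, (∀ A ∈ 𝓗, A ⊆ U → c • A = A) → c = 1

/-- The translates of `D` by the non-trivial elements of `H` are disjoint from `D`. -/
def IsWandering (H : Subgroup Γ) (D : Set V) : Prop :=
  ∀ h ∈ H, h ≠ 1 → Disjoint (h • D) D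

/-- The domain of discontinuity of `H` is dense: every half-space contains one which is wandering
for `H`. -/
def IsSparse (𝓗 : Set (Set V)) (H : Subgroup Γ) : Prop :=
  ∀ D ∈ 𝓗, ∃ D' ∈ 𝓗, D' ⊆ D ∧ IsWandering H D'

theorem IsWandering.mono {H : Subgroup Γ} {D D' : Set V} (hD : IsWandering H D) (h : D' ⊆ D) :
    IsWandering H D' := fun k hk hk1 =>
  (hD k hk hk1).mono (Set.smul_set_mono h) h

theorem IsWandering.smul {H : Subgroup Γ} {D : Set V} (hD : IsWandering H D) {w : Γ}
    (hw : w ∈ H) : IsWandering H (w • D) := by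
  intro k hk hk1
  have h := hD (w⁻¹ * k * w) (H.mul_mem (H.mul_mem (H.inv_mem hw) hk) hw) (by
    intro h
    apply hk1
    have : k = w * (w⁻¹ * k * w) * w⁻¹ := by group
    rw [this, h]; group)
  rw [← Set.disjoint_smul_set (a := w⁻¹)]
  simpa [smul_smul, mul_assoc] using h

theorem isSparse_bot (𝓗 : Set (Set V)) : IsSparse 𝓗 (⊥ : Subgroup Γ) := fun D hD =>
  ⟨D, hD, subset_rfl, fun _ hh hh1 => absurd (Subgroup.mem_bot.1 hh) hh1⟩

namespace IsHalfspaceSystem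

variable {𝓗 : Set (Set V)}

theorem not_disjoint_of_subset (h𝓗 : IsHalfspaceSystem Γ 𝓗) {A B : Set V} (hA : A ∈ 𝓗) (h : A ⊆ B) :
    ¬ Disjoint A B := by
  obtain ⟨x, hx⟩ := h𝓗.nonempty A hA
  exact Set.not_disjoint_iff.2 ⟨x, hx, h hx⟩

theorem exists_disjoint_pair (h𝓗 : IsHalfspaceSystem Γ 𝓗) {U : Set V} (hU : U ∈ 𝓗) :
    ∃ A ∈ 𝓗, ∃ B ∈ 𝓗, A ⊆ U ∧ B ⊆ U ∧ Disjoint A B := by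
  obtain ⟨A, hA, B, hB, C, hC, hAB, hAC, hBC⟩ := h𝓗.exists_facing_triple
  obtain ⟨g, hg⟩ := h𝓗.exists_smul_subset Cᶜ (h𝓗.compl_mem C hC) U hU
  refine ⟨g • A, h𝓗.smul_mem g A hA, g • B, h𝓗.smul_mem g B hB, ?_, ?_, ?_⟩
  · exact (Set.smul_set_mono hAC.subset_compl_right).trans hg
  · exact (Set.smul_set_mono hBC.subset_compl_right).trans hg
  · exact Set.disjoint_smul_set.2 hAB

/-- If `c` shrank `W` strictly, then the sets `c ^ n • W` would be infinitely many half-spaces between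
`W` and one of two disjoint half-spaces of `W`. -/
theorem smul_eq_self_of_subset (h𝓗 : IsHalfspaceSystem Γ 𝓗) {W : Set V} (hW : W ∈ 𝓗) {c : Γ}
    (hcW : c • W ⊆ W) (hc : ∀ A ∈ 𝓗, A ⊆ W → c • A ⊆ A ∨ A ⊆ c • A) : c • W = W := by
  by_contra hne
  obtain ⟨A, hA, B, hB, hAW, hBW, hAB⟩ := h𝓗.exists_disjoint_pair hW
  have hanti : ∀ n : ℕ, c ^ (n + 1) • W ⊂ c ^ n • W := by
    intro n
    rw [pow_succ, mul_smul]
    refine ⟨Set.smul_set_mono hcW, fun h => hne (hcW.antisymm ?_)⟩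
    exact Set.smul_set_subset_smul_set_iff.1 h
  have hstrict : StrictAnti fun n : ℕ => c ^ n • W := strictAnti_nat_of_succ_lt hanti
  have hsub : ∀ n : ℕ, c ^ n • W ⊆ W := fun n => by
    simpa using hstrict.antitone (Nat.zero_le n)
  have meets : ∀ A ∈ 𝓗, A ⊆ W → ∀ n : ℕ, ¬ Disjoint (c ^ n • W) A := by
    intro A hA hAW n
    rcases hc A hA hAW with h | h
    · have h1 : c ^ n • A ⊆ A := by
        induction n with
        | zero => simp
        | succ n ih =>
          rw [pow_succ, mul_smul]
          exact (Set.smul_set_mono h).trans ih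
      intro hd
      exact h𝓗.not_disjoint_of_subset (h𝓗.smul_mem (c ^ n) A hA) h1
        (hd.mono_left (Set.smul_set_mono hAW))
    · have h1 : A ⊆ c ^ n • A := by
        induction n with
        | zero => simp
        | succ n ih =>
          rw [pow_succ, mul_smul]
          exact ih.trans (Set.smul_set_mono h)
      intro hd
      exact h𝓗.not_disjoint_of_subset hA (h1.trans (Set.smul_set_mono hAW)) hd.symm
  have hAn : ∀ n : ℕ, A ⊆ c ^ n • W := by
    intro n
    rcases h𝓗.nested _ (h𝓗.smul_mem (c ^ n) W hW) A hA with h | h | h | h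
    · exact absurd h (meets A hA hAW n)
    · exact absurd (hAB.mono_left h) (meets B hB hBW n)
    · exact h
    · obtain ⟨x, hx⟩ := h𝓗.nonempty _ (h𝓗.compl_mem W hW)
      exact absurd (hAW (h fun hx' => hx (hsub n hx'))) hx
  have hmem : ∀ n : ℕ, c ^ n • W ∈ {C | C ∈ 𝓗 ∧ A ⊆ C ∧ C ⊆ W} := fun n =>
    ⟨h𝓗.smul_mem (c ^ n) W hW, hAn n, hsub n⟩
  exact Set.infinite_of_injective_forall_mem hstrict.injective hmem (h𝓗.finite_between A hA W hW)

/-- Topological freeness: a non-trivial element displaces some half-space contained in a given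
one. -/
theorem exists_disjoint_smul (h𝓗 : IsHalfspaceSystem Γ 𝓗) {U : Set V} (hU : U ∈ 𝓗) {c : Γ}
    (hc : c ≠ 1) : ∃ A ∈ 𝓗, A ⊆ U ∧ Disjoint (c • A) A := by
  by_contra! hcon
  obtain ⟨W, hW, W', hW', hWU, hWU', hd⟩ := h𝓗.exists_disjoint_pair hU
  have hcmp : ∀ A ∈ 𝓗, A ⊆ W → c • A ⊆ A ∨ A ⊆ c • A := by
    intro A hA hAW
    rcases h𝓗.nested _ (h𝓗.smul_mem c A hA) A hA with h | h | h | h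
    · exact absurd h (hcon A hA (hAW.trans hWU))
    · exact Or.inl h
    · exact Or.inr h
    · exfalso
      refine hcon W' hW' hWU' ?_
      have h1 : W' ⊆ c • A := by
        rw [Set.compl_subset_comm] at h
        exact (hd.mono_left hAW).subset_compl_left.trans h
      exact ((Set.disjoint_smul_set (a := c)).2 (hd.mono_left hAW).symm).mono_right h1
  refine hc (h𝓗.eq_one_of_forall_smul_eq W hW c fun A hA hAW => ?_)
  rcases hcmp A hA hAW with h | h
  · exact h𝓗.smul_eq_self_of_subset hA h fun B hB hBA => hcmp B hB (hBA.trans hAW)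
  · have := h𝓗.smul_eq_self_of_subset (c := c⁻¹) hA (Set.subset_smul_set_iff.1 h)
      fun B hB hBA => by
        rw [← Set.subset_smul_set_iff, ← Set.smul_set_subset_iff_subset_inv_smul_set]
        exact (hcmp B hB (hBA.trans hAW)).symm
    rw [inv_smul_eq_iff] at this
    exact this.symm

/-- For two elements `x`, `y`, a half-space can be shrunk so that its translate by `y` is disjoint from
all its translates by elements of the coset `H x`, except possibly `y` itself. -/
theorem exists_disjoint_translates_pair (h𝓗 : IsHalfspaceSystem Γ 𝓗) {H : Subgroup Γ}
    (hH : IsSparse 𝓗 H) (x y : Γ) {U : Set V} (hU : U ∈ 𝓗) :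
    ∃ U' ∈ 𝓗, U' ⊆ U ∧ ∀ h ∈ H, h * x ≠ y → Disjoint ((h * x) • U') (y • U') := by
  obtain ⟨D, hD, hDU, hDw⟩ := hH _ (h𝓗.smul_mem y U hU)
  obtain ⟨W, rfl⟩ : ∃ W, D = y • W := ⟨y⁻¹ • D, by simp⟩
  have hW : W ∈ 𝓗 := by simpa using h𝓗.smul_mem y⁻¹ _ hD
  have hWU : W ⊆ U := Set.smul_set_subset_smul_set_iff.1 hDU
  by_cases hex : ∃ A ∈ 𝓗, A ⊆ W ∧ ∃ h ∈ H, (h * x) • A ⊆ y • W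
  · obtain ⟨A, hA, hAW, h, hh, hsub⟩ := hex
    obtain ⟨A', hA', hAA, hdis⟩ : ∃ A' ∈ 𝓗, A' ⊆ A ∧
        (h * x ≠ y → Disjoint ((h * x) • A') (y • A')) := by
      by_cases hxy : h * x = y
      · exact ⟨A, hA, subset_rfl, fun h => absurd hxy h⟩
      · obtain ⟨A', hA', h1, h2⟩ := h𝓗.exists_disjoint_smul hA (c := y⁻¹ * (h * x))
          (by rwa [Ne, inv_mul_eq_one, eq_comm])
        refine ⟨A', hA', h1, fun _ => ?_⟩
        rw [← Set.disjoint_smul_set (a := y⁻¹)]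
        simpa [smul_smul] using h2
    -- since `y • W` is wandering, `h` is the only element of `H` for which disjointness can fail
    refine ⟨A', hA', (hAA.trans hAW).trans hWU, fun k hk hne => ?_⟩
    by_cases hkh : k = h
    · subst hkh
      exact hdis hne
    · -- `k x A'` lies in `k h⁻¹ y W`, a translate of `y W` by a non-trivial element of `H`
      have h1 := hDw (k * h⁻¹) (H.mul_mem hk (H.inv_mem hh))
        (by rwa [Ne, mul_inv_eq_one])
      refine h1.mono ?_ (Set.smul_set_mono (hAA.trans hAW))
      have h2 := Set.smul_set_mono (a := k * h⁻¹) ((Set.smul_set_mono hAA).trans hsub)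
      rwa [smul_smul, show k * h⁻¹ * (h * x) = k * x by group] at h2
  · -- no `H`-translate of `x • A` is contained in `y • W` for a half-space `A` of `W`, nor conversely,
    -- so that it only remains to exclude pairs of half-spaces covering `V`
    push Not at hex
    obtain ⟨A, hA, B, hB, hAW, hBW, hAB⟩ := h𝓗.exists_disjoint_pair hW
    have key : ∀ C ∈ 𝓗, C ⊆ W → ∀ h ∈ H, ¬ y • C ⊆ (h * x) • W := by
      intro C hC hCW h hh hsub
      refine hex ((h * x)⁻¹ • y • C) (h𝓗.smul_mem _ _ (h𝓗.smul_mem _ _ hC)) ?_ h hh ?_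
      · exact Set.subset_smul_set_iff.1 hsub
      · rw [smul_inv_smul]
        exact Set.smul_set_mono hCW
    refine ⟨A, hA, hAW.trans hWU, fun h hh _ => ?_⟩
    rcases h𝓗.nested _ (h𝓗.smul_mem (h * x) A hA) _ (h𝓗.smul_mem y A hA) with h1 | h1 | h1 | h1
    · exact h1
    · exact absurd (h1.trans (Set.smul_set_mono hAW)) (hex A hA hAW h hh)
    · exact absurd (h1.trans (Set.smul_set_mono hAW)) (key A hA hAW h hh)
    · refine absurd (Set.Subset.trans ?_ (Set.smul_set_mono hAW)) (key B hB hBW h hh)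
      rw [Set.compl_subset_comm] at h1
      exact ((Set.disjoint_smul_set (a := y)).2 hAB.symm).subset_compl_right.trans h1

theorem exists_disjoint_translates (h𝓗 : IsHalfspaceSystem Γ 𝓗) {H : Subgroup Γ}
    (hH : IsSparse 𝓗 H) (S : Set Γ) (hS : S.Finite) {U : Set V} (hU : U ∈ 𝓗) :
    ∃ U' ∈ 𝓗, U' ⊆ U ∧
      ∀ x ∈ S, ∀ y ∈ S, ∀ h ∈ H, h * x ≠ y → Disjoint ((h * x) • U') (y • U') := by
  have main : ∀ P : Set (Γ × Γ), P.Finite → ∃ U' ∈ 𝓗, U' ⊆ U ∧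
      ∀ p ∈ P, ∀ h ∈ H, h * p.1 ≠ p.2 → Disjoint ((h * p.1) • U') (p.2 • U') := by
    intro P hP
    induction P, hP using Set.Finite.induction_on with
    | empty => exact ⟨U, hU, subset_rfl, by simp⟩
    | @insert p P _ _ ih =>
      obtain ⟨U₁, hU₁, hsub₁, h₁⟩ := ih
      obtain ⟨U₂, hU₂, hsub₂, h₂⟩ := h𝓗.exists_disjoint_translates_pair hH p.1 p.2 hU₁
      refine ⟨U₂, hU₂, hsub₂.trans hsub₁, ?_⟩
      rintro q (rfl | hq)
      · exact h₂
      · exact fun h hh hne => (h₁ q hq h hh hne).mono (Set.smul_set_mono hsub₂)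
          (Set.smul_set_mono hsub₂)
  obtain ⟨U', hU', hsub, h⟩ := main (S ×ˢ S) (hS.prod hS)
  exact ⟨U', hU', hsub, fun x hx y hy => h (x, y) ⟨hx, hy⟩⟩

/-- Let `A` and `C` be disjoint half-spaces such that `F` moves `A` away from `C`. If `z` moves the
complement of `C` into a wandering half-space `D`, then every `z * g * z⁻¹` with `g ∈ F` moves a
part of `D` into `D`, and hence is not in `H`. -/
theorem exists_forall_conj_notMem (h𝓗 : IsHalfspaceSystem Γ 𝓗) {H : Subgroup Γ}
    (hH : IsSparse 𝓗 H) (F : Finset Γ) (hF : 1 ∉ F) :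
    ∃ x : Γ, ∀ g ∈ F, x⁻¹ * g * x ∉ H := by
  obtain ⟨U₀, hU₀, -⟩ := h𝓗.exists_facing_triple
  obtain ⟨U, hU, -, hsep⟩ := h𝓗.exists_disjoint_translates hH (insert 1 (F : Set Γ))
    (F.finite_toSet.insert 1) hU₀
  obtain ⟨A, hA, C, hC, hAU, hCU, hAC⟩ := h𝓗.exists_disjoint_pair hU
  obtain ⟨D, hD, -, hDw⟩ := hH U hU
  obtain ⟨z, hz⟩ := h𝓗.exists_smul_subset Cᶜ (h𝓗.compl_mem C hC) D hD
  refine ⟨z⁻¹, fun g hg hmem => ?_⟩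
  rw [inv_inv] at hmem
  have hg1 : g ≠ 1 := fun h => hF (h ▸ hg)
  have h1 : Disjoint (g • U) U := by
    simpa using hsep g (by simp [hg]) 1 (by simp) 1 H.one_mem (by simpa using hg1)
  have h2 : z • A ⊆ D := (Set.smul_set_mono hAC.subset_compl_right).trans hz
  have h3 : z • g • A ⊆ D :=
    (Set.smul_set_mono (h1.mono (Set.smul_set_mono hAU) hCU).subset_compl_right).trans hz
  have h4 := hDw _ hmem (by
    intro h
    apply hg1
    rw [mul_inv_eq_one] at h
    simpa using h)
  refine h𝓗.not_disjoint_of_subset (h𝓗.smul_mem z _ (h𝓗.smul_mem g A hA)) h3 (h4.mono_left ?_)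
  have h5 := Set.smul_set_mono (a := z * g * z⁻¹) h2
  rwa [smul_smul, show z * g * z⁻¹ * z = z * g by group, mul_smul] at h5

end IsHalfspaceSystem

end Halfspaces

/-! ### Ping-pong relative to a subgroup -/

section PingPong

variable {Γ : Type*} [Group Γ] {V : Type*} [MulAction Γ V]

/-- Ping-pong data relative to `H`: the map `t τ` sends the complement of the piece `P τ` onto the
piece `P (inv τ)`, and the translates of the pieces by `H` are pairwise disjoint. -/
structure IsPingPong (H : Subgroup Γ) {J : Type*} (inv : J → J) (t : J → Γ) (P : J → Set V) :
    Prop where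
  t_inv : ∀ τ, t (inv τ) = (t τ)⁻¹
  smul_compl : ∀ τ, t τ • (P τ)ᶜ = P (inv τ)
  disjoint : ∀ h ∈ H, ∀ τ σ, ¬ (h = 1 ∧ τ = σ) → Disjoint (h • P τ) (P σ)

/-- The subgroup generated by `H` and the ping-pong elements. -/
def pingPongGroup (H : Subgroup Γ) {J : Type*} (t : J → Γ) : Subgroup Γ :=
  H ⊔ Subgroup.closure (Set.range t)

/-- A set which is wandering for `H` and whose `H`-translates avoid the pieces, that is, a set from
which ping-pong can be started. -/
structure IsBase (H : Subgroup Γ) {J : Type*} (P : J → Set V) (D : Set V) : Prop where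
  wandering : IsWandering H D
  disjoint : ∀ h ∈ H, ∀ τ, Disjoint (h • D) (P τ)

namespace IsPingPong

variable {H : Subgroup Γ} {J : Type*} {inv : J → J} {t : J → Γ} {P : J → Set V}

/-- The products `h₁ t₁ h₂ t₂ ⋯ hₙ` in which no cancellation takes place: each letter `t τ` is applied
outside of the piece `P τ`. Each such product which is not in `H` sends `D` into a piece. -/
inductive ReducedWord (H : Subgroup Γ) (t : J → Γ) (P : J → Set V) (D : Set V) : Γ → Prop
  | base (h : Γ) (hh : h ∈ H) : ReducedWord H t P D h
  | step (h : Γ) (hh : h ∈ H) (τ : J) (w : Γ) (hw : ReducedWord H t P D w)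
      (hd : Disjoint (w • D) (P τ)) : ReducedWord H t P D (h * t τ * w)

theorem ReducedWord.subset (hP : IsPingPong H inv t P) {D : Set V} {w : Γ}
    (hw : ReducedWord H t P D w) : w ∈ H ∨ ∃ h ∈ H, ∃ τ, w • D ⊆ h • P τ := by
  cases hw with
  | base h hh => exact Or.inl hh
  | step h hh τ w hw hd =>
    refine Or.inr ⟨h, hh, inv τ, ?_⟩
    rw [mul_smul, mul_smul, ← hP.smul_compl]
    exact Set.smul_set_mono (Set.smul_set_mono hd.subset_compl_right)

theorem ReducedWord.mul_left {D : Set V} {h w : Γ} (hh : h ∈ H)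
    (hw : ReducedWord H t P D w) : ReducedWord H t P D (h * w) := by
  cases hw with
  | base k hk => exact .base _ (H.mul_mem hh hk)
  | step k hk τ w hw hd =>
    rw [← mul_assoc, ← mul_assoc]
    exact .step _ (H.mul_mem hh hk) τ w hw hd

theorem ReducedWord.t_mul (hP : IsPingPong H inv t P) {D : Set V} (hD : IsBase H P D) (σ : J)
    {w : Γ} (hw : ReducedWord H t P D w) : ReducedWord H t P D (t σ * w) := by
  by_cases hd : Disjoint (w • D) (P σ)
  · simpa using ReducedWord.step 1 H.one_mem σ w hw hd
  · cases hw with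
    | base _ hh => exact absurd (hD.disjoint w hh σ) hd
    | step h hh τ w hw hd' =>
      have hsub : (h * t τ * w) • D ⊆ h • P (inv τ) := by
        rw [mul_smul, mul_smul, ← hP.smul_compl]
        exact Set.smul_set_mono (Set.smul_set_mono hd'.subset_compl_right)
      by_cases hc : h = 1 ∧ inv τ = σ
      · obtain ⟨rfl, rfl⟩ := hc
        simpa [hP.t_inv] using hw
      · exact absurd ((hP.disjoint h hh _ _ hc).mono_left hsub) hd

theorem subset_piece (hP : IsPingPong H inv t P) {D : Set V} (hD : IsBase H P D) {w : Γ}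
    (hw : w ∈ pingPongGroup H t) : w ∈ H ∨ ∃ h ∈ H, ∃ τ, w • D ⊆ h • P τ := by
  refine ReducedWord.subset hP (D := D) ?_
  rw [pingPongGroup, ← Subgroup.closure_eq H, ← Subgroup.closure_union] at hw
  induction hw using Subgroup.closure_induction_left with
  | one => exact .base 1 H.one_mem
  | mul_left x hx y _ ih =>
    rcases hx with hx | ⟨τ, rfl⟩
    · exact ih.mul_left hx
    · exact ih.t_mul hP hD τ
  | inv_mul_cancel x hx y _ ih =>
    rcases hx with hx | ⟨τ, rfl⟩
    · exact ih.mul_left (H.inv_mem hx)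
    · rw [← hP.t_inv]
      exact ih.t_mul hP hD _

theorem mem_of_mem_left {h : Γ} (hh : h ∈ H) : h ∈ pingPongGroup H t :=
  (le_sup_left : H ≤ _) hh

theorem t_mem (τ : J) : t τ ∈ pingPongGroup H t :=
  (le_sup_right : Subgroup.closure (Set.range t) ≤ _) (Subgroup.subset_closure ⟨τ, rfl⟩)

theorem disjoint_smul_piece {D : Set V} (hD : IsBase H P D) {h : Γ} (hh : h ∈ H)
    (τ : J) : Disjoint D (h • P τ) := by
  rw [← Set.disjoint_smul_set (a := h⁻¹), inv_smul_smul]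
  exact hD.disjoint _ (H.inv_mem hh) τ

theorem isWandering_pingPongGroup (hP : IsPingPong H inv t P) {D : Set V} (hD : IsBase H P D) :
    IsWandering (pingPongGroup H t) D := by
  intro w hw hw1
  rcases hP.subset_piece hD hw with h | ⟨h, hh, τ, hsub⟩
  · exact hD.wandering w h hw1
  · exact (disjoint_smul_piece hD hh τ).symm.mono_left hsub

variable {𝓗 : Set (Set V)}

/-- Each `H`-translate of a piece contains a translate of the base half-space, since `P τ` is the
image by `(t τ)⁻¹` of the complement of `P (inv τ)`. -/
theorem exists_wandering_subset_piece (hP : IsPingPong H inv t P) (h𝓗 : IsHalfspaceSystem Γ 𝓗)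
    {D₀ : Set V} (hD₀𝓗 : D₀ ∈ 𝓗) (hD₀ : IsBase H P D₀) {h : Γ} (hh : h ∈ H) (τ : J) :
    ∃ D' ∈ 𝓗, D' ⊆ h • P τ ∧ IsWandering (pingPongGroup H t) D' := by
  have hw : h * (t τ)⁻¹ ∈ pingPongGroup H t :=
    (pingPongGroup H t).mul_mem (mem_of_mem_left hh) ((pingPongGroup H t).inv_mem (t_mem τ))
  refine ⟨(h * (t τ)⁻¹) • D₀, h𝓗.smul_mem _ _ hD₀𝓗, ?_,
    (hP.isWandering_pingPongGroup hD₀).smul hw⟩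
  rw [mul_smul]
  refine Set.smul_set_mono ?_
  have h1 := hP.smul_compl τ
  have h2 : Disjoint D₀ (P (inv τ)) := by simpa using hD₀.disjoint 1 H.one_mem (inv τ)
  rw [← h1, Set.smul_set_compl, Set.disjoint_compl_right_iff_subset] at h2
  rw [← Set.subset_smul_set_iff]
  exact h2

/-- A half-space without wandering half-spaces contains neither the base half-space nor a translate
of a piece, so that it is contained in a translate of a piece or disjoint from all of them. In the
second case its `H`-wandering half-spaces are base sets. -/
theorem subset_piece_of_forall_not_isWandering (hP : IsPingPong H inv t P)
    (h𝓗 : IsHalfspaceSystem Γ 𝓗)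
    (hH : IsSparse 𝓗 H) (hP𝓗 : ∀ τ, P τ ∈ 𝓗)
    {D₀ : Set V} (hD₀𝓗 : D₀ ∈ 𝓗) (hD₀ : IsBase H P D₀) {D : Set V} (hD : D ∈ 𝓗)
    (hbad : ∀ D' ∈ 𝓗, D' ⊆ D → ¬ IsWandering (pingPongGroup H t) D') :
    ∃ h ∈ H, ∃ τ, D ⊆ h • P τ := by
  by_contra! hcon
  have hdisj : ∀ h ∈ H, ∀ τ, Disjoint D (h • P τ) := by
    intro h hh τ
    rcases h𝓗.nested D hD _ (h𝓗.smul_mem h _ (hP𝓗 τ)) with h1 | h1 | h1 | h1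
    · exact h1
    · exact absurd h1 (hcon h hh τ)
    · obtain ⟨D', hD', hsub, hw⟩ := hP.exists_wandering_subset_piece h𝓗 hD₀𝓗 hD₀ hh τ
      exact absurd hw (hbad D' hD' (hsub.trans h1))
    · refine absurd (hP.isWandering_pingPongGroup hD₀) (hbad D₀ hD₀𝓗 ?_)
      rw [Set.compl_subset_comm] at h1
      exact (disjoint_smul_piece hD₀ hh τ).subset_compl_right.trans h1
  obtain ⟨D', hD', hsub, hw⟩ := hH D hD
  refine hbad D' hD' hsub (hP.isWandering_pingPongGroup ⟨hw, fun h hh τ => ?_⟩)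
  rw [← Set.disjoint_smul_set (a := h⁻¹), inv_smul_smul]
  exact (hdisj _ (H.inv_mem hh) τ).mono_left hsub

/-- A half-space without wandering half-spaces cannot be contained in a translate `h • P τ` of a
piece. Otherwise `t τ * h⁻¹` sends it into another translate of a piece, and the interval between
the half-space and the piece containing it becomes shorter, which cannot go on forever. -/
theorem not_subset_piece_of_forall_not_isWandering (hP : IsPingPong H inv t P)
    (h𝓗 : IsHalfspaceSystem Γ 𝓗)
    (hH : IsSparse 𝓗 H) (hP𝓗 : ∀ τ, P τ ∈ 𝓗)
    {D₀ : Set V} (hD₀𝓗 : D₀ ∈ 𝓗) (hD₀ : IsBase H P D₀) (n : ℕ) :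
    ∀ D ∈ 𝓗, (∀ D' ∈ 𝓗, D' ⊆ D → ¬ IsWandering (pingPongGroup H t) D') →
      ∀ h ∈ H, ∀ τ, D ⊆ h • P τ → ¬ {C | C ∈ 𝓗 ∧ D ⊆ C ∧ C ⊆ h • P τ}.ncard = n := by
  induction n using Nat.strong_induction_on with
  | _ n ih =>
    intro D hD hbad h hh τ hsub hn
    have hw : t τ * h⁻¹ ∈ pingPongGroup H t :=
      (pingPongGroup H t).mul_mem (t_mem τ) (mem_of_mem_left (H.inv_mem hh))
    set w := t τ * h⁻¹ with hw_def
    have hwD : w • D ∈ 𝓗 := h𝓗.smul_mem w D hD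
    have hbad' : ∀ D' ∈ 𝓗, D' ⊆ w • D → ¬ IsWandering (pingPongGroup H t) D' :=
      fun D' hD' hsub' hwand => hbad (w⁻¹ • D') (h𝓗.smul_mem _ _ hD')
        (Set.smul_set_subset_iff_subset_inv_smul_set.2 (by simpa using hsub'))
        (hwand.smul ((pingPongGroup H t).inv_mem hw))
    obtain ⟨k, hk, σ, hkσ⟩ :=
      hP.subset_piece_of_forall_not_isWandering h𝓗 hH hP𝓗 hD₀𝓗 hD₀ hwD hbad'
    have hcompl : w • h • P τ = (P (inv τ))ᶜ := by
      rw [smul_smul, hw_def, inv_mul_cancel_right, ← hP.smul_compl, Set.smul_set_compl, compl_compl]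
    have hdis : Disjoint (k • P σ) (P (inv τ)) := by
      refine hP.disjoint k hk σ (inv τ) fun ⟨h1, h2⟩ => ?_
      subst h1 h2
      have h3 := Set.smul_set_mono (a := w) hsub
      rw [hcompl] at h3
      rw [one_smul] at hkσ
      obtain ⟨x, hx⟩ := h𝓗.nonempty _ hwD
      exact h3 hx (hkσ hx)
    have hle : k • P σ ⊆ w • h • P τ := by
      rw [hcompl]
      exact hdis.subset_compl_right
    refine ih _ ?_ (w • D) hwD hbad' k hk σ hkσ rfl
    rw [← hn, ← Set.ncard_image_of_injective _ (MulAction.injective (β := Set V) w⁻¹)]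
    refine Set.ncard_lt_ncard (Set.ssubset_iff_subset_ne.2 ⟨?_, fun heq => ?_⟩)
      (h𝓗.finite_between D hD _ (h𝓗.smul_mem h _ (hP𝓗 τ)))
    · rintro _ ⟨C, ⟨hC, hDC, hCk⟩, rfl⟩
      refine ⟨h𝓗.smul_mem _ _ hC, Set.subset_smul_set_iff.2 (by simpa using hDC), ?_⟩
      exact Set.smul_set_subset_iff_subset_inv_smul_set.2 (by simpa using hCk.trans hle)
    · -- the piece `h • P τ` is not the image of a member of the second interval
      have hmem : h • P τ ∈ {C | C ∈ 𝓗 ∧ D ⊆ C ∧ C ⊆ h • P τ} :=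
        ⟨h𝓗.smul_mem h _ (hP𝓗 τ), hsub, subset_rfl⟩
      rw [← heq] at hmem
      obtain ⟨C, ⟨-, -, hCk⟩, hC⟩ := hmem
      have hC' : C = (P (inv τ))ᶜ := by
        rw [← hcompl, ← hC]
        simp
      have h1 : Disjoint D₀ (P (inv τ)) := by simpa using hD₀.disjoint 1 H.one_mem (inv τ)
      exact h𝓗.not_disjoint_of_subset hD₀𝓗 ((h1.subset_compl_right.trans hC'.ge).trans hCk)
        (disjoint_smul_piece hD₀ hk σ)

theorem isSparse_pingPongGroup (hP : IsPingPong H inv t P) (h𝓗 : IsHalfspaceSystem Γ 𝓗)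
    (hH : IsSparse 𝓗 H) (hP𝓗 : ∀ τ, P τ ∈ 𝓗)
    {D₀ : Set V} (hD₀𝓗 : D₀ ∈ 𝓗) (hD₀ : IsBase H P D₀) : IsSparse 𝓗 (pingPongGroup H t) := by
  by_contra hcon
  simp only [IsSparse] at hcon
  push Not at hcon
  obtain ⟨D, hD, hbad⟩ := hcon
  obtain ⟨h, hh, τ, hsub⟩ := hP.subset_piece_of_forall_not_isWandering h𝓗 hH hP𝓗 hD₀𝓗 hD₀ hD hbad
  exact hP.not_subset_piece_of_forall_not_isWandering h𝓗 hH hP𝓗 hD₀𝓗 hD₀ _ D hD hbad h hh τ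
    hsub rfl

end IsPingPong
end PingPong

/-! ### Construction of the action -/

section Construction

variable {Γ : Type*} [Group Γ] {V : Type*} [MulAction Γ V] {𝓗 : Set (Set V)}

namespace IsHalfspaceSystem

/-- A sparse subgroup `H` can be enlarged to a sparse subgroup `H'` such that a single element maps
the coset `a i H'` to `b i H'` for all `i`, without catching any of finitely many elements outside
of `H`. -/
theorem exists_sparse_extension (h𝓗 : IsHalfspaceSystem Γ 𝓗) {H : Subgroup Γ}
    (hH : IsSparse 𝓗 H) {ι : Type*} [Finite ι] (a b : ι → Γ)
    (ha : ∀ i j, (a i)⁻¹ * a j ∈ H → i = j) (hb : ∀ i j, (b i)⁻¹ * b j ∈ H → i = j)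
    (E : Set Γ) (hE : E.Finite) (hEH : ∀ e ∈ E, e ∉ H) :
    ∃ H' : Subgroup Γ, H ≤ H' ∧ IsSparse 𝓗 H' ∧ (∀ e ∈ E, e ∉ H') ∧
      ∃ g : Γ, ∀ i, (b i)⁻¹ * g * a i ∈ H' := by
  set S : Set Γ := Set.range (fun i => (a i)⁻¹) ∪ Set.range (fun i => (b i)⁻¹) ∪ insert 1 E
    with hS_def
  have hS : S.Finite := ((Set.finite_range _).union (Set.finite_range _)).union (hE.insert 1)
  have haS : ∀ i, (a i)⁻¹ ∈ S := fun i => Or.inl (Or.inl ⟨i, rfl⟩)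
  have hbS : ∀ i, (b i)⁻¹ ∈ S := fun i => Or.inl (Or.inr ⟨i, rfl⟩)
  have hES : ∀ e ∈ E, e ∈ S := fun e he => Or.inr (Or.inr he)
  have h1S : (1 : Γ) ∈ S := Or.inr (Or.inl rfl)
  obtain ⟨U₀, hU₀, -⟩ := h𝓗.exists_facing_triple
  obtain ⟨W, hW, -, hsep⟩ := h𝓗.exists_disjoint_translates hH S hS hU₀
  -- three disjoint half-spaces in `W`
  obtain ⟨U, hU, W', hW', hUW, hWW', hUW'⟩ := h𝓗.exists_disjoint_pair hW
  obtain ⟨Q, hQ, D, hD, hQW', hDW', hQD⟩ := h𝓗.exists_disjoint_pair hW'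
  obtain ⟨g, hg⟩ := h𝓗.exists_smul_subset Uᶜ (h𝓗.compl_mem U hU) Q hQ
  have hgW : g • Uᶜ ⊆ W := hg.trans (hQW'.trans hWW')
  have hDW : D ⊆ W := hDW'.trans hWW'
  have hUg : Disjoint U (g • Uᶜ) := hUW'.mono_right (hg.trans hQW')
  have hUD : Disjoint U D := hUW'.mono_right hDW'
  have hgD : Disjoint (g • Uᶜ) D := hQD.mono_left hg
  have key : ∀ h ∈ H, ∀ x ∈ S, ∀ y ∈ S, ∀ A B : Set V, A ⊆ W → B ⊆ W →
      (h * x = y → Disjoint A B) → Disjoint (h • x • A) (y • B) := by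
    intro h hh x hx y hy A B hA hB hAB
    rw [smul_smul]
    by_cases hxy : h * x = y
    · rw [hxy]
      exact Set.disjoint_smul_set.2 (hAB hxy)
    · exact (hsep x hx y hy h hh hxy).mono (Set.smul_set_mono hA) (Set.smul_set_mono hB)
  -- replacing the second half-space by `g • Uᶜ` makes the image of the complement of a piece a piece
  let t : ι ⊕ ι → Γ := Sum.elim (fun i => (b i)⁻¹ * g * a i) (fun i => ((b i)⁻¹ * g * a i)⁻¹)
  let P : ι ⊕ ι → Set V := Sum.elim (fun i => (a i)⁻¹ • U) (fun i => (b i)⁻¹ • g • Uᶜ)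
  have hP : IsPingPong H Sum.swap t P := by
    refine ⟨?_, ?_, ?_⟩
    · rintro (i | i) <;> simp [t]
    · rintro (i | i)
      · simp [t, P, mul_smul, Set.smul_set_compl]
      · simp [t, P, mul_smul, Set.smul_set_compl]
    · rintro h hh (i | i) (j | j) hne
      · refine key h hh _ (haS i) _ (haS j) U U hUW hUW fun heq => absurd ?_ hne
        have h1 : h = (a j)⁻¹ * a i := by rw [← heq]; group
        obtain rfl := ha j i (h1 ▸ hh)
        exact ⟨by simpa using h1, rfl⟩
      · exact key h hh _ (haS i) _ (hbS j) U _ hUW hgW fun _ => hUg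
      · exact key h hh _ (hbS i) _ (haS j) _ U hgW hUW fun _ => hUg.symm
      · refine key h hh _ (hbS i) _ (hbS j) _ _ hgW hgW fun heq => absurd ?_ hne
        have h1 : h = (b j)⁻¹ * b i := by rw [← heq]; group
        obtain rfl := hb j i (h1 ▸ hh)
        exact ⟨by simpa using h1, rfl⟩
  have hP𝓗 : ∀ τ, P τ ∈ 𝓗 := by
    rintro (i | i)
    · exact h𝓗.smul_mem _ _ hU
    · exact h𝓗.smul_mem _ _ (h𝓗.smul_mem _ _ (h𝓗.compl_mem U hU))
  have hDP : ∀ e ∈ S, ∀ h ∈ H, ∀ τ, Disjoint (h • e • D) (P τ) := by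
    rintro e he h hh (i | i)
    · exact key h hh e he _ (haS i) D U hDW hUW fun _ => hUD.symm
    · exact key h hh e he _ (hbS i) D _ hDW hgW fun _ => hgD.symm
  have hbase : IsBase H P D := by
    refine ⟨fun h hh h1 => ?_, fun h hh τ => by simpa using hDP 1 h1S h hh τ⟩
    simpa using key h hh 1 h1S 1 h1S D D hDW hDW fun heq => absurd (by simpa using heq) h1
  refine ⟨pingPongGroup H t, fun h hh => IsPingPong.mem_of_mem_left hh,
    hP.isSparse_pingPongGroup h𝓗 hH hP𝓗 hD hbase, fun e he hmem => ?_,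
    g, fun i => IsPingPong.t_mem (t := t) (Sum.inl i)⟩
  rcases hP.subset_piece hbase hmem with h | ⟨h, hh, τ, hsub⟩
  · exact hEH e he h
  · refine h𝓗.not_disjoint_of_subset (h𝓗.smul_mem e D hD) hsub ?_
    rw [← Set.disjoint_smul_set (a := h⁻¹), inv_smul_smul]
    exact hDP e (hES e he) _ (H.inv_mem hh) τ

/-- The union of a chain of sparse subgroups, along which all pairs of tuples of cosets and all finite
subsets of `Γ` are treated in turn. The elements to be kept out of the subgroup are accumulated in a
finite set. -/
theorem exists_subgroup [Countable Γ] (h𝓗 : IsHalfspaceSystem Γ 𝓗) :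
    ∃ H : Subgroup Γ,
      (∀ (k : ℕ) (a b : Fin k → Γ), (∀ i j, (a i)⁻¹ * a j ∈ H → i = j) →
        (∀ i j, (b i)⁻¹ * b j ∈ H → i = j) → ∃ g : Γ, ∀ i, (b i)⁻¹ * g * a i ∈ H) ∧
      ∀ F : Finset Γ, 1 ∉ F → ∃ x : Γ, ∀ g ∈ F, x⁻¹ * g * x ∉ H := by
  let State := {p : Subgroup Γ × Set Γ // IsSparse 𝓗 p.1 ∧ p.2.Finite ∧ ∀ e ∈ p.2, e ∉ p.1}
  let Task := (Σ k : ℕ, (Fin k → Γ) × (Fin k → Γ)) × Finset Γ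
  have step : ∀ (s : State) (τ : Task), ∃ s' : State, s.1.1 ≤ s'.1.1 ∧ s.1.2 ⊆ s'.1.2 ∧
      ((∀ i j, (τ.1.2.1 i)⁻¹ * τ.1.2.1 j ∈ s.1.1 → i = j) →
        (∀ i j, (τ.1.2.2 i)⁻¹ * τ.1.2.2 j ∈ s.1.1 → i = j) →
        ∃ g : Γ, ∀ i, (τ.1.2.2 i)⁻¹ * g * τ.1.2.1 i ∈ s'.1.1) ∧
      (1 ∉ τ.2 → ∃ x : Γ, ∀ g ∈ τ.2, x⁻¹ * g * x ∈ s'.1.2) := by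
    rintro ⟨⟨H, E⟩, hH, hE, hEH⟩ ⟨⟨k, a, b⟩, F⟩
    obtain ⟨H', hle, hH', hEH', hg⟩ : ∃ H' : Subgroup Γ, H ≤ H' ∧ IsSparse 𝓗 H' ∧
        (∀ e ∈ E, e ∉ H') ∧ ((∀ i j, (a i)⁻¹ * a j ∈ H → i = j) →
          (∀ i j, (b i)⁻¹ * b j ∈ H → i = j) → ∃ g : Γ, ∀ i, (b i)⁻¹ * g * a i ∈ H') := by
      by_cases hab : (∀ i j, (a i)⁻¹ * a j ∈ H → i = j) ∧ (∀ i j, (b i)⁻¹ * b j ∈ H → i = j)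
      · obtain ⟨H', h1, h2, h3, h4⟩ := h𝓗.exists_sparse_extension hH a b hab.1 hab.2 E hE hEH
        exact ⟨H', h1, h2, h3, fun _ _ => h4⟩
      · exact ⟨H, le_rfl, hH, hEH, fun ha hb => absurd ⟨ha, hb⟩ hab⟩
    by_cases hF : 1 ∈ F
    · exact ⟨⟨(H', E), hH', hE, hEH'⟩, hle, subset_rfl, hg, fun h => absurd hF h⟩
    · obtain ⟨x, hx⟩ := h𝓗.exists_forall_conj_notMem hH' F hF
      refine ⟨⟨(H', E ∪ (fun g => x⁻¹ * g * x) '' F), hH', hE.union (F.finite_toSet.image _), ?_⟩,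
        hle, Set.subset_union_left, hg, fun _ => ⟨x, fun g hg => Or.inr ⟨g, hg, rfl⟩⟩⟩
      rintro e (he | ⟨g, hg, rfl⟩)
      · exact hEH' e he
      · exact hx g hg
  choose next hnextH hnextE hnexta hnextF using step
  obtain ⟨task, htask⟩ : ∃ f : ℕ → Task, Function.Surjective f :=
    haveI : Nonempty Task := ⟨⟨⟨0, 1, 1⟩, ∅⟩⟩
    exists_surjective_nat Task
  let s₀ : State := ⟨(⊥, ∅), isSparse_bot 𝓗, Set.finite_empty, by simp⟩
  let s : ℕ → State := fun n => Nat.rec s₀ (fun n s => next s (task n)) n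
  have hmonoH : Monotone fun n => (s n).1.1 := monotone_nat_of_le_succ fun n => hnextH _ _
  have hmonoE : Monotone fun n => (s n).1.2 := monotone_nat_of_le_succ fun n => hnextE _ _
  have hmem : ∀ x : Γ, x ∈ (⨆ n, (s n).1.1) ↔ ∃ n, x ∈ (s n).1.1 := fun x =>
    Subgroup.mem_iSup_of_directed hmonoH.directed_le
  refine ⟨⨆ n, (s n).1.1, fun k a b ha hb => ?_, fun F hF => ?_⟩
  · obtain ⟨n, hn⟩ := htask ⟨⟨k, a, b⟩, ∅⟩
    have h1 := hnexta (s n) (task n)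
    rw [hn] at h1
    obtain ⟨g, hg⟩ := h1 (fun i j h => ha i j ((hmem _).2 ⟨n, h⟩))
      (fun i j h => hb i j ((hmem _).2 ⟨n, h⟩))
    refine ⟨g, fun i => (hmem _).2 ⟨n + 1, ?_⟩⟩
    have h2 : s (n + 1) = next (s n) ⟨⟨k, a, b⟩, ∅⟩ := by rw [← hn]
    rw [h2]
    exact hg i
  · obtain ⟨n, hn⟩ := htask ⟨⟨0, 1, 1⟩, F⟩
    have h1 := hnextF (s n) (task n)
    rw [hn] at h1
    obtain ⟨x, hx⟩ := h1 hF
    refine ⟨x, fun g hg hgm => ?_⟩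
    obtain ⟨m, hm⟩ := (hmem _).1 hgm
    have h2 : s (n + 1) = next (s n) ⟨⟨0, 1, 1⟩, F⟩ := by rw [← hn]
    have h3 : x⁻¹ * g * x ∈ (s (n + 1)).1.2 := by rw [h2]; exact hx g hg
    exact (s (max m (n + 1))).2.2.2 _ (hmonoE (le_max_right _ _) h3) (hmonoH (le_max_left _ _) hm)

theorem exists_three_distinct (h𝓗 : IsHalfspaceSystem Γ 𝓗) :
    ∃ x y : Γ, x ≠ 1 ∧ y ≠ 1 ∧ x ≠ y := by
  obtain ⟨A, hA, B, hB, C, hC, hAB, hAC, hBC⟩ := h𝓗.exists_facing_triple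
  obtain ⟨x, hx⟩ := h𝓗.exists_smul_subset A hA B hB
  obtain ⟨y, hy⟩ := h𝓗.exists_smul_subset A hA C hC
  refine ⟨x, y, ?_, ?_, ?_⟩
  · rintro rfl
    rw [one_smul] at hx
    exact h𝓗.not_disjoint_of_subset hA hx hAB
  · rintro rfl
    rw [one_smul] at hy
    exact h𝓗.not_disjoint_of_subset hA hy hAC
  · rintro rfl
    exact h𝓗.not_disjoint_of_subset (h𝓗.smul_mem x A hA) hy (hBC.mono_left hx)

/-- The action on the cosets of the subgroup of `exists_subgroup`, transported to `ℕ`. -/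
theorem exists_action [Countable Γ] (h𝓗 : IsHalfspaceSystem Γ 𝓗) :
    ∃ (X : Type) (_ : Countable X) (_ : Infinite X) (_ : MulAction Γ X),
      IsHighlyTransitiveAction Γ X ∧ IsHighlyFaithfulAction Γ X := by
  obtain ⟨H, hHa, hHF⟩ := h𝓗.exists_subgroup
  have hbot : H ≠ ⊥ := by
    rintro rfl
    obtain ⟨x, y, hx, hy, hxy⟩ := h𝓗.exists_three_distinct
    obtain ⟨g, hg⟩ := hHa 2 ![1, x] ![1, y] (by simp [Fin.forall_fin_two, hx])
      (by simp [Fin.forall_fin_two, hy])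
    have h0 := hg 0
    have h1 := hg 1
    simp only [Subgroup.mem_bot] at h0 h1
    simp at h0
    subst h0
    simp [inv_mul_eq_one] at h1
    exact hxy h1.symm
  obtain ⟨h, hh, h1⟩ := (Subgroup.ne_bot_iff_exists_ne_one).1 hbot |> fun ⟨h, hne⟩ =>
    (⟨h.1, h.2, fun h' => hne (Subtype.ext h')⟩ : ∃ h ∈ H, h ≠ 1)
  have hfaith : IsHighlyFaithfulAction Γ (Γ ⧸ H) := by
    classical
    intro F hF hfin
    -- if only finitely many cosets were moved by all of `F`, one could add to `F` a non-trivial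
    -- element of the stabilizer of each of them
    have hout : ∀ q : Γ ⧸ H, q.out * h * q.out⁻¹ ≠ 1 := fun q hq => h1 (by simpa using hq)
    obtain ⟨x, hx⟩ := hHF (F ∪ hfin.toFinset.image fun q => q.out * h * q.out⁻¹) (by
      simp only [Finset.mem_union, Finset.mem_image, not_or, not_exists, not_and]
      exact ⟨hF, fun q _ => hout q⟩)
    have hxmem : (x : Γ ⧸ H) ∈ {q : Γ ⧸ H | ∀ g ∈ F, g • q ≠ q} := by
      intro g hg heq
      refine hx g (Finset.mem_union_left _ hg) ?_
      rw [MulAction.Quotient.smul_coe, eq_comm, QuotientGroup.eq] at heq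
      simpa [mul_assoc] using heq
    refine hx _ (Finset.mem_union_right _
      (Finset.mem_image_of_mem _ (hfin.mem_toFinset.2 hxmem))) ?_
    have hxo : x⁻¹ * (x : Γ ⧸ H).out ∈ H := by
      rw [← QuotientGroup.eq, QuotientGroup.out_eq']
    have := H.mul_mem (H.mul_mem hxo hh) (H.inv_mem hxo)
    simpa [mul_assoc] using this
  have hinf : Infinite (Γ ⧸ H) := by
    have := hfaith ∅ (by simp)
    simpa [Set.infinite_univ_iff] using this
  have htrans : IsHighlyTransitiveAction Γ (Γ ⧸ H) := by
    intro k
    refine ⟨fun p q => ?_⟩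
    have hdist : ∀ r : Fin k ↪ Γ ⧸ H, ∀ i j, (r i).out⁻¹ * (r j).out ∈ H → i = j := by
      intro r i j hij
      rw [← QuotientGroup.eq, QuotientGroup.out_eq', QuotientGroup.out_eq'] at hij
      exact r.injective hij
    obtain ⟨g, hg⟩ := hHa k (fun i => (p i).out) (fun i => (q i).out) (hdist p) (hdist q)
    refine ⟨g, Function.Embedding.ext fun i => ?_⟩
    rw [Function.Embedding.smul_apply, ← QuotientGroup.out_eq' (p i), ← QuotientGroup.out_eq' (q i),
      MulAction.Quotient.smul_coe, eq_comm, QuotientGroup.eq]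
    simpa [mul_assoc] using hg i
  have hcount : Countable (Γ ⧸ H) := Quotient.countable
  obtain ⟨e⟩ : Nonempty (ℕ ≃ Γ ⧸ H) := by
    obtain ⟨d⟩ := nonempty_denumerable (Γ ⧸ H)
    exact ⟨(Denumerable.eqv _).symm⟩
  let act : MulAction Γ ℕ := e.mulAction Γ
  have hsmul : ∀ (g : Γ) (n : ℕ), e (g • n) = g • e n := fun g n => e.apply_symm_apply _
  refine ⟨ℕ, inferInstance, inferInstance, act, fun k => ⟨fun p q => ?_⟩, fun F hF => ?_⟩
  · obtain ⟨g, hg⟩ := (htrans k).exists_smul_eq (p.trans e.toEmbedding) (q.trans e.toEmbedding)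
    refine ⟨g, Function.Embedding.ext fun i => e.injective ?_⟩
    have := DFunLike.congr_fun hg i
    rw [Function.Embedding.smul_apply, hsmul]
    simpa [Function.Embedding.smul_apply] using this
  · have := (hfaith F hF).preimage (f := e) (fun x _ => e.surjective x)
    exact this.mono fun n (hn : ∀ g ∈ F, g • e n ≠ e n) g hg heq => hn g hg (by rw [← hsmul, heq])

end IsHalfspaceSystem

theorem IsHighlyFaithfulAction.faithfulSMul {X : Type*} [MulAction Γ X]
    (h : IsHighlyFaithfulAction Γ X) : FaithfulSMul Γ X := by
  refine ⟨fun {g g'} hgg => ?_⟩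
  by_contra hne
  obtain ⟨x, hx⟩ := (h {g'⁻¹ * g} (by
    simpa [inv_mul_eq_one, eq_comm] using Ne.symm hne)).nonempty
  exact hx _ (Finset.mem_singleton_self _) (by rw [mul_smul, hgg x, inv_smul_smul])

end Construction

/-! ### Half-trees of a tree -/

section Trees

variable {V : Type*} {T : SimpleGraph V}

theorem dist_add_dist_of_mem_support (hT : T.Connected) {x y z : V} {p : T.Walk x z}
    (hp : p.length = T.dist x z) (hy : y ∈ p.support) :
    T.dist x y + T.dist y z = T.dist x z := by
  classical
  refine le_antisymm ?_ hT.dist_triangle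
  have h := congrArg SimpleGraph.Walk.length (p.take_spec hy)
  rw [SimpleGraph.Walk.length_append, hp] at h
  have h1 := SimpleGraph.dist_le (p.takeUntil y hy)
  have h2 := SimpleGraph.dist_le (p.dropUntil y hy)
  omega

/-- A point of a geodesic segment is determined by its distance to one of the end points. -/
theorem eq_of_dist_eq (hT : T.IsTree) {x y y' z : V}
    (hy : T.dist x y + T.dist y z = T.dist x z) (hy' : T.dist x y' + T.dist y' z = T.dist x z)
    (h : T.dist x y = T.dist x y') : y = y' := by
  have key : ∀ w : V, T.dist x w + T.dist w z = T.dist x z →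
      ∃ p : T.Walk x z, p.IsPath ∧ p.getVert (T.dist x w) = w := by
    intro w hw
    obtain ⟨p, hp⟩ := hT.connected.exists_walk_length_eq_dist x w
    obtain ⟨q, hq⟩ := hT.connected.exists_walk_length_eq_dist w z
    refine ⟨p.append q, SimpleGraph.Walk.isPath_of_length_eq_dist _ ?_, ?_⟩
    · rw [SimpleGraph.Walk.length_append, hp, hq, hw]
    · rw [SimpleGraph.Walk.getVert_append, hp]
      simp
  obtain ⟨p, hp, hpy⟩ := key y hy
  obtain ⟨q, hq, hqy⟩ := key y' hy'
  have hpq : p = q :=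
    congrArg Subtype.val ((hT.isAcyclic.subsingleton_path _ _).elim ⟨p, hp⟩ ⟨q, hq⟩)
  rw [← hpy, ← hqy, hpq, h]

/-- The vertices on the side of `b`, when `a` and `b` are adjacent vertices of a tree. -/
def halfTree (T : SimpleGraph V) (a b : V) : Set V :=
  {v | T.dist v b < T.dist v a}

theorem compl_halfTree (hT : T.IsTree) {a b : V} (hab : T.Adj a b) :
    (halfTree T a b)ᶜ = halfTree T b a := by
  ext v
  have := hT.dist_ne_of_adj v hab
  simp only [halfTree, Set.mem_compl_iff, Set.mem_ofPred_eq]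
  omega

theorem right_mem_halfTree {a b : V} (hab : T.Adj a b) : b ∈ halfTree T a b := by
  have := SimpleGraph.dist_eq_one_iff_adj.2 hab.symm
  simp [halfTree, this]

theorem left_notMem_halfTree (a b : V) : a ∉ halfTree T a b := by
  simp [halfTree]

/-- Any path between the two sides of an edge passes through the edge. -/
theorem dist_eq_of_notMem_of_mem (hT : T.IsTree) {a b x z : V} (hab : T.Adj a b)
    (hx : x ∉ halfTree T a b) (hz : z ∈ halfTree T a b) :
    T.dist x z = T.dist x a + 1 + T.dist b z := by
  have hx' : x ∈ halfTree T b a := by rwa [← compl_halfTree hT hab]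
  simp only [halfTree, Set.mem_ofPred_eq] at hx' hz
  obtain ⟨p, hp, hpl⟩ := hT.connected.exists_path_of_dist x a
  obtain ⟨q, hq, hql⟩ := hT.connected.exists_path_of_dist b z
  have hpath : (p.append (SimpleGraph.Walk.cons hab q)).IsPath := by
    rw [SimpleGraph.Walk.isPath_def, SimpleGraph.Walk.support_append, SimpleGraph.Walk.support_cons,
      List.tail_cons, List.nodup_append']
    refine ⟨hp.support_nodup, hq.support_nodup, fun y hyp hyq => ?_⟩
    have h1 := dist_add_dist_of_mem_support hT.connected hpl hyp
    have h2 := dist_add_dist_of_mem_support hT.connected hql hyq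
    have h3 : T.dist x b ≤ T.dist x y + T.dist y b := hT.connected.dist_triangle
    have h4 : T.dist z a ≤ T.dist z y + T.dist y a := hT.connected.dist_triangle
    rw [T.dist_comm (u := b) (v := y), T.dist_comm (u := y) (v := z),
      T.dist_comm (u := b) (v := z)] at h2
    omega
  obtain ⟨r, hr, hrl⟩ := hT.connected.exists_path_of_dist x z
  have heq : r = p.append (SimpleGraph.Walk.cons hab q) :=
    congrArg Subtype.val ((hT.isAcyclic.subsingleton_path _ _).elim ⟨r, hr⟩ ⟨_, hpath⟩)
  rw [← hrl, heq, SimpleGraph.Walk.length_append, SimpleGraph.Walk.length_cons, hpl, hql]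
  omega

theorem mem_halfTree_of_between (hT : T.IsTree) {a b x y z : V} (hab : T.Adj a b)
    (hx : x ∈ halfTree T a b) (hz : z ∈ halfTree T a b)
    (hy : T.dist x y + T.dist y z = T.dist x z) : y ∈ halfTree T a b := by
  by_contra hcon
  have h1 := dist_eq_of_notMem_of_mem hT hab hcon hx
  have h2 := dist_eq_of_notMem_of_mem hT hab hcon hz
  have h3 : T.dist x z ≤ T.dist x b + T.dist b z := hT.connected.dist_triangle
  rw [T.dist_comm (u := y) (v := x)] at h1
  rw [T.dist_comm (u := b) (v := x)] at h1
  omega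

theorem left_between (hT : T.IsTree) {a b x z : V} (hab : T.Adj a b)
    (hx : x ∉ halfTree T a b) (hz : z ∈ halfTree T a b) :
    T.dist x a + T.dist a z = T.dist x z := by
  have h1 := dist_eq_of_notMem_of_mem hT hab hx hz
  have h2 := dist_eq_of_notMem_of_mem hT hab (left_notMem_halfTree a b) hz
  simp only [SimpleGraph.dist_self] at h2
  omega

theorem right_between (hT : T.IsTree) {a b x z : V} (hab : T.Adj a b)
    (hx : x ∉ halfTree T a b) (hz : z ∈ halfTree T a b) :
    T.dist x b + T.dist b z = T.dist x z := by
  have h1 := dist_eq_of_notMem_of_mem hT hab hx hz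
  have h2 := dist_eq_of_notMem_of_mem hT hab hx (right_mem_halfTree hab)
  simp only [SimpleGraph.dist_self] at h2
  omega

/-- By convexity, a half-tree which meets both sides of an edge contains the edge. -/
theorem edge_mem_halfTree (hT : T.IsTree) {a b c d x z : V} (hab : T.Adj a b) (hcd : T.Adj c d)
    (hx : x ∉ halfTree T a b) (hz : z ∈ halfTree T a b)
    (hx' : x ∈ halfTree T c d) (hz' : z ∈ halfTree T c d) :
    a ∈ halfTree T c d ∧ b ∈ halfTree T c d :=
  ⟨mem_halfTree_of_between hT hcd hx' hz' (left_between hT hab hx hz),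
    mem_halfTree_of_between hT hcd hx' hz' (right_between hT hab hx hz)⟩

theorem edge_eq_of_halfTree_eq (hT : T.IsTree) {a b a' b' : V} (hab : T.Adj a b)
    (hab' : T.Adj a' b') (h : halfTree T a b = halfTree T a' b') : a = a' ∧ b = b' := by
  have h1 := dist_eq_of_notMem_of_mem hT hab' (h ▸ left_notMem_halfTree a b)
    (h ▸ right_mem_halfTree hab)
  rw [SimpleGraph.dist_eq_one_iff_adj.2 hab] at h1
  exact ⟨hT.connected.dist_eq_zero_iff.1 (by omega),
    (hT.connected.dist_eq_zero_iff.1 (by omega : T.dist b' b = 0)).symm⟩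

theorem halfTree_nested (hT : T.IsTree) {a b c d : V} (hab : T.Adj a b) (hcd : T.Adj c d) :
    Disjoint (halfTree T a b) (halfTree T c d) ∨ halfTree T a b ⊆ halfTree T c d ∨
      halfTree T c d ⊆ halfTree T a b ∨ (halfTree T a b)ᶜ ⊆ halfTree T c d := by
  by_contra! hcon
  obtain ⟨h1, h2, h3, h4⟩ := hcon
  obtain ⟨x, hx, hx'⟩ := Set.not_disjoint_iff.1 h1
  obtain ⟨y, hy, hy'⟩ := Set.not_subset.1 h2
  obtain ⟨z, hz, hz'⟩ := Set.not_subset.1 h3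
  obtain ⟨w, hw, hw'⟩ := Set.not_subset.1 h4
  have e1 := (edge_mem_halfTree hT hab hcd hz' hx hz hx').1
  rw [← Set.mem_compl_iff, compl_halfTree hT hcd] at hy' hw'
  have e2 := (edge_mem_halfTree hT hab hcd.symm hw hy hw' hy').1
  rw [← compl_halfTree hT hcd] at e2
  exact e2 e1

theorem finite_between_points (hT : T.IsTree) (x z : V) :
    {y | T.dist x y + T.dist y z = T.dist x z}.Finite := by
  refine Set.Finite.of_injOn (f := fun y => T.dist x y) (t := Set.Iic (T.dist x z))
    (fun y hy => ?_) (fun y hy y' hy' h => eq_of_dist_eq hT hy hy' h) (Set.finite_Iic _)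
  simp only [Set.mem_ofPred_eq] at hy
  simp only [Set.mem_Iic]
  omega

/-- The set of all half-trees of a graph. -/
def halfTrees (T : SimpleGraph V) : Set (Set V) :=
  {A | ∃ a b, T.Adj a b ∧ halfTree T a b = A}

theorem finite_between_halfTrees (hT : T.IsTree) {A B : Set V} (hA : A ∈ halfTrees T)
    (hB : B ∈ halfTrees T) : {C | C ∈ halfTrees T ∧ A ⊆ C ∧ C ⊆ B}.Finite := by
  obtain ⟨a, b, hab, rfl⟩ := hA
  obtain ⟨c, d, hcd, rfl⟩ := hB
  have hK := finite_between_points hT c b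
  refine (hK.image2 (halfTree T) hK).subset ?_
  rintro _ ⟨⟨p, q, hpq, rfl⟩, hA, hB⟩
  have hc : c ∉ halfTree T p q := fun h => left_notMem_halfTree c d (hB h)
  have hb : b ∈ halfTree T p q := hA (right_mem_halfTree hab)
  exact ⟨p, left_between hT hpq hc hb, q, right_between hT hpq hc hb, rfl⟩

section Lines

theorem IsGeodesicLine.dist_eq {ℓ : ℤ → V} (hℓ : IsGeodesicLine T ℓ) (i j : ℤ) :
    T.dist (ℓ i) (ℓ j) = (i - j).natAbs := by
  rcases le_total i j with h | h
  · obtain ⟨n, rfl⟩ := Int.le.dest h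
    rw [hℓ i n]
    omega
  · obtain ⟨n, rfl⟩ := Int.le.dest h
    rw [SimpleGraph.dist_comm, hℓ j n]
    omega

theorem IsGeodesicLine.adj {ℓ : ℤ → V} (hℓ : IsGeodesicLine T ℓ) (i : ℤ) :
    T.Adj (ℓ i) (ℓ (i + 1)) := by
  rw [← SimpleGraph.dist_eq_one_iff_adj, hℓ.dist_eq]
  omega

theorem IsGeodesicLine.reverse {ℓ : ℤ → V} (hℓ : IsGeodesicLine T ℓ) :
    IsGeodesicLine T fun i => ℓ (-i) := by
  intro i n
  rw [hℓ.dist_eq]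
  omega

theorem IsGeodesicLine.isGeodesicRay {ℓ : ℤ → V} (hℓ : IsGeodesicLine T ℓ) :
    IsGeodesicRay T fun i : ℕ => ℓ i := by
  intro i n
  rw [hℓ.dist_eq]
  omega

/-- The half-tree cut off from a line at its `i`-th edge, on the side of its positive end. -/
def lineHalfTree (T : SimpleGraph V) (ℓ : ℤ → V) (i : ℤ) : Set V :=
  halfTree T (ℓ i) (ℓ (i + 1))

theorem lineHalfTree_mem {ℓ : ℤ → V} (hℓ : IsGeodesicLine T ℓ) (i : ℤ) :
    lineHalfTree T ℓ i ∈ halfTrees T := ⟨_, _, hℓ.adj i, rfl⟩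

theorem mem_lineHalfTree_iff {ℓ : ℤ → V} (hℓ : IsGeodesicLine T ℓ) (i j : ℤ) :
    ℓ j ∈ lineHalfTree T ℓ i ↔ i < j := by
  simp only [lineHalfTree, halfTree, Set.mem_ofPred_eq, hℓ.dist_eq]
  omega

theorem lineHalfTree_antitone (hT : T.IsTree) {ℓ : ℤ → V} (hℓ : IsGeodesicLine T ℓ) :
    Antitone (lineHalfTree T ℓ) := by
  intro i j hij x hx
  rcases hij.eq_or_lt with rfl | hlt
  · exact hx
  have h1 := dist_eq_of_notMem_of_mem hT (hℓ.adj j)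
    (fun h => absurd ((mem_lineHalfTree_iff hℓ j i).1 h) (by omega)) hx
  have h2 := dist_eq_of_notMem_of_mem hT (hℓ.adj j) (x := ℓ (i + 1))
    (fun h => absurd ((mem_lineHalfTree_iff hℓ j (i + 1)).1 h) (by omega)) hx
  rw [hℓ.dist_eq] at h1 h2
  simp only [lineHalfTree, halfTree, Set.mem_ofPred_eq]
  rw [T.dist_comm (u := x), T.dist_comm (u := x) (v := ℓ i), h1, h2]
  omega

theorem compl_lineHalfTree (hT : T.IsTree) {ℓ : ℤ → V} (hℓ : IsGeodesicLine T ℓ) (i : ℤ) :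
    (lineHalfTree T ℓ i)ᶜ = lineHalfTree T (fun k => ℓ (-k)) (-(i + 1)) := by
  rw [lineHalfTree, compl_halfTree hT (hℓ.adj i), lineHalfTree]
  congr 2 <;> omega

theorem notMem_lineHalfTree_of_dist_le (hT : T.IsTree) {ℓ : ℤ → V} (hℓ : IsGeodesicLine T ℓ)
    {x : V} {i : ℤ} (hi : (T.dist (ℓ 0) x : ℤ) ≤ i) : x ∉ lineHalfTree T ℓ i := by
  intro hx
  have h1 := dist_eq_of_notMem_of_mem hT (hℓ.adj i)
    (fun h => absurd ((mem_lineHalfTree_iff hℓ i 0).1 h) (by omega)) hx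
  rw [hℓ.dist_eq] at h1
  omega

/-- If the half-trees of two lines meet at every index, then the geodesic from `ℓ' 0` to a common
point far away follows `ℓ` as well as `ℓ'`, so that the positive rays eventually coincide. -/
theorem mem_range_of_forall_not_disjoint (hT : T.IsTree) {ℓ ℓ' : ℤ → V}
    (hℓ : IsGeodesicLine T ℓ) (hℓ' : IsGeodesicLine T ℓ')
    (h : ∀ i, ¬ Disjoint (lineHalfTree T ℓ i) (lineHalfTree T ℓ' i)) {j : ℕ}
    (hj : T.dist (ℓ 0) (ℓ' 0) ≤ j) : ℓ j ∈ Set.range fun i : ℕ => ℓ' i := by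
  set D := T.dist (ℓ 0) (ℓ' 0) with hD
  obtain ⟨x, hx, hx'⟩ := Set.not_disjoint_iff.1 (h (D + j : ℕ))
  have h1 : ℓ' 0 ∉ lineHalfTree T ℓ j := notMem_lineHalfTree_of_dist_le hT hℓ (by omega)
  have h2 : x ∈ lineHalfTree T ℓ j := lineHalfTree_antitone hT hℓ (by omega) hx
  have h3 : T.dist (ℓ' 0) (ℓ j) ≤ D + j := by
    have h4 : T.dist (ℓ' 0) (ℓ j) ≤ T.dist (ℓ' 0) (ℓ 0) + T.dist (ℓ 0) (ℓ j) :=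
      hT.connected.dist_triangle
    have h5 := hℓ.dist_eq 0 j
    have h6 : T.dist (ℓ' 0) (ℓ 0) = D := T.dist_comm
    omega
  set m := T.dist (ℓ' 0) (ℓ j) with hm
  have h4 : ℓ' 0 ∉ lineHalfTree T ℓ' m := fun h => by
    have := (mem_lineHalfTree_iff hℓ' _ _).1 h
    omega
  have h5 : x ∈ lineHalfTree T ℓ' m := lineHalfTree_antitone hT hℓ' (by omega) hx'
  refine ⟨m, (eq_of_dist_eq hT (left_between hT (hℓ.adj j) h1 h2)
    (left_between hT (hℓ'.adj m) h4 h5) ?_).symm⟩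
  rw [hℓ'.dist_eq]
  omega

theorem finite_range_diff_range (hT : T.IsTree) {ℓ ℓ' : ℤ → V}
    (hℓ : IsGeodesicLine T ℓ) (hℓ' : IsGeodesicLine T ℓ')
    (h : ∀ i, ¬ Disjoint (lineHalfTree T ℓ i) (lineHalfTree T ℓ' i)) :
    (Set.range (fun i : ℕ => ℓ i) \ Set.range fun i : ℕ => ℓ' i).Finite := by
  refine ((Set.finite_Iio (T.dist (ℓ 0) (ℓ' 0))).image fun i : ℕ => ℓ i).subset ?_
  rintro _ ⟨⟨j, rfl⟩, hj⟩
  exact ⟨j, not_le.1 fun hle => hj (mem_range_of_forall_not_disjoint hT hℓ hℓ' h hle), rfl⟩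

end Lines

end Trees

section Axes

variable {Γ : Type*} [Group Γ] {V : Type*} [MulAction Γ V] {T : SimpleGraph V}

/-- The line `ℓ` is an axis of `g`, along which `g` translates by `n ≠ 0`. -/
structure IsAxis (T : SimpleGraph V) (g : Γ) (ℓ : ℤ → V) (n : ℤ) : Prop where
  isGeodesicLine : IsGeodesicLine T ℓ
  ne_zero : n ≠ 0
  smul_eq : ∀ k, g • ℓ k = ℓ (k + n)

theorem IsAxis.reverse {g : Γ} {ℓ : ℤ → V} {n : ℤ} (h : IsAxis T g ℓ n) :
    IsAxis T g (fun i => ℓ (-i)) (-n) := by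
  refine ⟨h.isGeodesicLine.reverse, neg_ne_zero.2 h.ne_zero, fun k => ?_⟩
  rw [h.smul_eq]
  congr 1
  ring

theorem IsAxis.zpow_smul {g : Γ} {ℓ : ℤ → V} {n : ℤ} (h : IsAxis T g ℓ n) (j k : ℤ) :
    g ^ j • ℓ k = ℓ (k + j * n) := by
  induction j using Int.induction_on generalizing k with
  | zero => simp
  | succ j ih =>
    rw [zpow_add_one, mul_smul, h.smul_eq, ih]
    congr 1
    ring
  | pred j ih =>
    have h1 : g⁻¹ • ℓ k = ℓ (k - n) := by
      rw [inv_smul_eq_iff, h.smul_eq]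
      congr 1
      ring
    rw [zpow_sub_one, mul_smul, h1, ih]
    congr 1
    ring

theorem smul_halfTree (hdist : ∀ (g : Γ) (x y : V), T.dist (g • x) (g • y) = T.dist x y) (g : Γ)
    (a b : V) : g • halfTree T a b = halfTree T (g • a) (g • b) := by
  ext x
  obtain ⟨y, rfl⟩ := MulAction.surjective g x
  rw [Set.smul_mem_smul_set_iff]
  simp [halfTree, hdist]

end Axes

/-! ### Half-trees under a group action -/

section HalfTreeSystem

variable {Γ : Type*} [Group Γ] {V : Type*} [MulAction Γ V] {T : SimpleGraph V}

/-- The action preserves the graph distance. -/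
structure IsIsometricAction (Γ : Type*) [Group Γ] {V : Type*} [MulAction Γ V]
    (T : SimpleGraph V) : Prop where
  dist_smul : ∀ (g : Γ) (x y : V), T.dist (g • x) (g • y) = T.dist x y

theorem IsIsometricAction.adj (hΓ : IsIsometricAction Γ T) (g : Γ) {a b : V} (h : T.Adj a b) :
    T.Adj (g • a) (g • b) := by
  rw [← SimpleGraph.dist_eq_one_iff_adj] at h ⊢
  rw [hΓ.dist_smul, h]

theorem IsIsometricAction.smul_mem_halfTrees (hΓ : IsIsometricAction Γ T) (g : Γ) {A : Set V}
    (hA : A ∈ halfTrees T) : g • A ∈ halfTrees T := by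
  obtain ⟨a, b, hab, rfl⟩ := hA
  exact ⟨_, _, hΓ.adj g hab, (smul_halfTree hΓ.dist_smul g a b).symm⟩

theorem compl_mem_halfTrees (hT : T.IsTree) {A : Set V} (hA : A ∈ halfTrees T) :
    Aᶜ ∈ halfTrees T := by
  obtain ⟨a, b, hab, rfl⟩ := hA
  exact ⟨b, a, hab.symm, (compl_halfTree hT hab).symm⟩

/-- Move the edge `(a, b)` of `A` into `B`: one of its two sides is then contained in `B`. -/
theorem exists_smul_subset_or_smul_compl_subset (hT : T.IsTree) (hΓ : IsIsometricAction Γ T)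
    (hmeet : ∀ A ∈ halfTrees T, ∀ v : V, ∃ g : Γ, g • v ∈ A)
    {A B : Set V} (hA : A ∈ halfTrees T) (hB : B ∈ halfTrees T) :
    ∃ g : Γ, g • A ⊆ B ∨ g • Aᶜ ⊆ B := by
  obtain ⟨a, b, hab, rfl⟩ := hA
  obtain ⟨g, hg⟩ := hmeet B hB a
  obtain ⟨c, d, hcd, rfl⟩ := hB
  refine ⟨g, ?_⟩
  have hgab := hΓ.adj g hab
  rw [Set.smul_set_compl, smul_halfTree hΓ.dist_smul]
  by_cases hgb : g • b ∈ halfTree T c d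
  · have key : ∀ p q, T.Adj p q → p ∈ halfTree T c d → c ∉ halfTree T p q →
        halfTree T p q ⊆ halfTree T c d := by
      intro p q hpq hp hc x hx
      by_contra hcon
      have h1 := (edge_mem_halfTree hT hpq hcd.symm hc hx (right_mem_halfTree hcd.symm)
        (by rwa [← compl_halfTree hT hcd])).1
      rw [← compl_halfTree hT hcd] at h1
      exact h1 hp
    by_cases hc : c ∈ halfTree T (g • a) (g • b)
    · right
      rw [compl_halfTree hT hgab]
      refine key _ _ hgab.symm hgb ?_
      rw [← compl_halfTree hT hgab]
      exact fun h => h hc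
    · exact Or.inl (key _ _ hgab hg hc)
  · -- the edge `g • (a, b)` is the edge `(d, c)`
    right
    have h1 := dist_eq_of_notMem_of_mem hT hcd hgb hg
    rw [SimpleGraph.dist_eq_one_iff_adj.2 hgab.symm] at h1
    have h2 := hT.connected.dist_eq_zero_iff.1 (by omega : T.dist (g • b) c = 0)
    have h3 := hT.connected.dist_eq_zero_iff.1 (by omega : T.dist d (g • a) = 0)
    rw [compl_halfTree hT hgab, h2, h3]

theorem IsAxis.smul_lineHalfTree (hΓ : IsIsometricAction Γ T) {g : Γ} {ℓ : ℤ → V} {n : ℤ}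
    (h : IsAxis T g ℓ n) (j i : ℤ) :
    g ^ j • lineHalfTree T ℓ i = lineHalfTree T ℓ (i + j * n) := by
  rw [lineHalfTree, smul_halfTree hΓ.dist_smul, h.zpow_smul, h.zpow_smul, lineHalfTree]
  congr 2
  ring

/-- Powers of `g` push any translate of `A` arbitrarily far along the axis. -/
theorem IsAxis.exists_smul_subset (hT : T.IsTree) (hΓ : IsIsometricAction Γ T) {g : Γ}
    {ℓ : ℤ → V} {n : ℤ} (h : IsAxis T g ℓ n) {A : Set V} {k : Γ} {i₀ : ℤ}
    (hk : k • A ⊆ lineHalfTree T ℓ i₀) (i : ℤ) : ∃ k' : Γ, k' • A ⊆ lineHalfTree T ℓ i := by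
  refine ⟨g ^ (|i - i₀| * n.sign) * k, ?_⟩
  rw [mul_smul]
  refine (Set.smul_set_mono hk).trans ?_
  rw [h.smul_lineHalfTree hΓ]
  refine lineHalfTree_antitone hT h.isGeodesicLine ?_
  have h1 : |i - i₀| * n.sign * n = |i - i₀| * |n| := by rw [mul_assoc, Int.sign_mul_self_eq_abs]
  have h2 : |i - i₀| * 1 ≤ |i - i₀| * |n| :=
    mul_le_mul_of_nonneg_left (Int.one_le_abs h.ne_zero) (abs_nonneg _)
  have h3 := le_abs_self (i - i₀)
  rw [h1]
  linarith

/-- The line `L` is the line `ℓ` or its reverse. -/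
def IsOrientation (L ℓ : ℤ → V) : Prop := L = ℓ ∨ L = fun i => ℓ (-i)

/-- Every neighbourhood of one of the two ends of the axis contains a translate of `A`: by the
dichotomy applied to the complement of `A`, some translate of `A` is on one side of an edge of the
axis. -/
theorem IsAxis.exists_end (hT : T.IsTree) (hΓ : IsIsometricAction Γ T)
    (hmeet : ∀ A ∈ halfTrees T, ∀ v : V, ∃ g : Γ, g • v ∈ A)
    {g : Γ} {ℓ : ℤ → V} {n : ℤ} (h : IsAxis T g ℓ n) {A : Set V} (hA : A ∈ halfTrees T) :
    ∃ L, IsOrientation L ℓ ∧ ∀ i, ∃ k : Γ, k • A ⊆ lineHalfTree T L i := by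
  obtain ⟨k, hk | hk⟩ := exists_smul_subset_or_smul_compl_subset hT hΓ hmeet
    (lineHalfTree_mem h.isGeodesicLine 0) (compl_mem_halfTrees hT hA)
  · refine ⟨_, Or.inr rfl, h.reverse.exists_smul_subset hT hΓ (k := k⁻¹) (i₀ := -(0 + 1)) ?_⟩
    rw [← compl_lineHalfTree hT h.isGeodesicLine, Set.smul_set_subset_iff_subset_inv_smul_set,
      inv_inv, Set.smul_set_compl, Set.subset_compl_comm]
    exact hk
  · refine ⟨_, Or.inl rfl, h.exists_smul_subset hT hΓ (k := k⁻¹) (i₀ := 0) ?_⟩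
    rw [Set.smul_set_subset_iff_subset_inv_smul_set, inv_inv, ← Set.compl_subset_compl,
      ← Set.smul_set_compl]
    exact hk

theorem smul_eq_of_forall_smul_halfTree_eq (hT : T.IsTree) (hΓ : IsIsometricAction Γ T)
    {U : Set V} (hU : U ∈ halfTrees T) {c : Γ} (hc : ∀ A ∈ halfTrees T, A ⊆ U → c • A = A)
    {v : V} (hv : v ∈ U) : c • v = v := by
  obtain ⟨a, b, hab, rfl⟩ := hU
  -- the neighbour `w` of `v` in the direction of `a`
  obtain ⟨w, hwv, hw⟩ : ∃ w, T.Adj w v ∧ a ∉ halfTree T w v := by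
    obtain ⟨p, hp⟩ := hT.connected.exists_walk_length_eq_dist v a
    cases p with
    | nil => exact absurd hv (left_notMem_halfTree _ _)
    | @cons _ w _ hvw q =>
      refine ⟨w, hvw.symm, ?_⟩
      have h1 := SimpleGraph.dist_le q
      rw [SimpleGraph.Walk.length_cons] at hp
      simp only [halfTree, Set.mem_ofPred_eq, T.dist_comm (u := a)]
      omega
  have hsub : halfTree T w v ⊆ halfTree T a b := by
    intro x hx
    by_contra hcon
    have h1 := (edge_mem_halfTree hT hwv hab.symm hw hx (right_mem_halfTree hab.symm)
      (by rwa [← compl_halfTree hT hab])).2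
    rw [← compl_halfTree hT hab] at h1
    exact h1 hv
  have h1 := hc _ ⟨w, v, hwv, rfl⟩ hsub
  rw [smul_halfTree hΓ.dist_smul] at h1
  exact (edge_eq_of_halfTree_eq hT (hΓ.adj c hwv) hwv h1).2

/-- The half-trees form a system of half-spaces. The main point is that a half-tree `A` can be moved
into its complement: an end of each of the two axes attracts translates of `A`, and these ends are
distinct. -/
theorem isHalfspaceSystem_halfTrees (hT : T.IsTree) (hΓ : IsIsometricAction Γ T)
    (hmeet : ∀ A ∈ halfTrees T, ∀ v : V, ∃ g : Γ, g • v ∈ A)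
    {g h : Γ} {ℓ ℓ' : ℤ → V} {n m : ℤ} (hg : IsAxis T g ℓ n) (hh : IsAxis T h ℓ' m)
    (hends : ∀ L L', IsOrientation L ℓ → IsOrientation L' ℓ' →
      ∃ i, Disjoint (lineHalfTree T L i) (lineHalfTree T L' i))
    (hball : ∃ (u : V) (N : ℕ), ∀ c : Γ, (∀ v, T.dist u v ≤ N → c • v = v) → c = 1) :
    IsHalfspaceSystem Γ (halfTrees T) := by
  have hmove : ∀ A ∈ halfTrees T, ∀ B ∈ halfTrees T, ∃ g : Γ, g • A ⊆ B := by
    intro A hA B hB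
    obtain ⟨k, hk | hk⟩ := exists_smul_subset_or_smul_compl_subset hT hΓ hmeet hA hB
    · exact ⟨k, hk⟩
    · obtain ⟨L, hL, hLA⟩ := hg.exists_end hT hΓ hmeet hA
      obtain ⟨L', hL', hLA'⟩ := hh.exists_end hT hΓ hmeet hA
      obtain ⟨i, hi⟩ := hends L L' hL hL'
      obtain ⟨x, hx⟩ := hLA i
      obtain ⟨y, hy⟩ := hLA' i
      refine ⟨k * (y⁻¹ * x), ?_⟩
      rw [mul_smul]
      refine (Set.smul_set_mono (Disjoint.subset_compl_right ?_)).trans hk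
      rw [← Set.disjoint_smul_set (a := y), smul_smul, mul_inv_cancel_left]
      exact hi.mono hx hy
  refine ⟨?_, fun A hA => compl_mem_halfTrees hT hA, fun g A hA => hΓ.smul_mem_halfTrees g hA,
    ?_, fun A hA B hB => finite_between_halfTrees hT hA hB, hmove, ?_, ?_⟩
  · rintro _ ⟨a, b, hab, rfl⟩
    exact ⟨b, right_mem_halfTree hab⟩
  · rintro _ ⟨a, b, hab, rfl⟩ _ ⟨c, d, hcd, rfl⟩
    exact halfTree_nested hT hab hcd
  · -- neighbourhoods of the two ends of `ℓ` and of one end of `ℓ'`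
    have hℓ := hg.isGeodesicLine
    obtain ⟨i, hi⟩ := hends ℓ ℓ' (Or.inl rfl) (Or.inl rfl)
    obtain ⟨j, hj⟩ := hends (fun i => ℓ (-i)) ℓ' (Or.inr rfl) (Or.inl rfl)
    set k := max 0 (max i j) with hk
    refine ⟨_, lineHalfTree_mem hℓ k, _, lineHalfTree_mem hℓ.reverse k, _,
      lineHalfTree_mem hh.isGeodesicLine k, ?_, ?_, ?_⟩
    · have h1 := compl_lineHalfTree hT hℓ (-k - 1)
      rw [show -(-k - 1 + 1) = k by ring] at h1
      rw [← h1, Set.disjoint_compl_right_iff_subset]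
      exact lineHalfTree_antitone hT hℓ (by omega)
    · exact hi.mono (lineHalfTree_antitone hT hℓ (by omega))
        (lineHalfTree_antitone hT hh.isGeodesicLine (by omega))
    · exact hj.mono (lineHalfTree_antitone hT hℓ.reverse (by omega))
        (lineHalfTree_antitone hT hh.isGeodesicLine (by omega))
  · intro U hU c hc
    have hℓ := hg.isGeodesicLine
    obtain ⟨u, N, hN⟩ := hball
    -- the half-tree of `ℓ` with index `i` is disjoint from the ball
    set i : ℤ := N + T.dist (ℓ 0) u with hi
    have hfar : ∀ v, T.dist u v ≤ N → v ∈ (lineHalfTree T ℓ i)ᶜ := by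
      intro v hv
      refine notMem_lineHalfTree_of_dist_le hT hℓ ?_
      have : T.dist (ℓ 0) v ≤ T.dist (ℓ 0) u + T.dist u v := hT.connected.dist_triangle
      omega
    obtain ⟨x, hx⟩ := hmove _ (compl_mem_halfTrees hT (lineHalfTree_mem hℓ i)) U hU
    have h1 : x⁻¹ * c * x = 1 := by
      refine hN _ fun v hv => ?_
      have h2 := smul_eq_of_forall_smul_halfTree_eq hT hΓ hU hc
        (hx (Set.smul_mem_smul_set (hfar v hv)))
      rw [mul_smul, mul_smul, h2, inv_smul_smul]
    rw [mul_assoc, inv_mul_eq_one] at h1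
    simpa using h1.symm

end HalfTreeSystem

/-! ### The hypotheses on the action -/

section Automorphisms

variable {Γ : Type*} [Group Γ] {V : Type*} {T : SimpleGraph V}

/-- The vertices whose orbit avoids a half-tree form an invariant convex set, hence an invariant
subtree if there are any. -/
theorem IsMinimal.exists_apply_mem_halfTree (hT : T.IsTree) {ρ : Γ →* (T ≃g T)}
    (hmin : IsMinimal ρ) {A : Set V} (hA : A ∈ halfTrees T) (v : V) : ∃ g : Γ, ρ g v ∈ A := by
  by_contra! hcon
  obtain ⟨a, b, hab, rfl⟩ := hA
  set s : Set V := {x | ∀ g : Γ, ρ g x ∉ halfTree T a b} with hs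
  have hconn : (T.induce s).Connected := by
    have hne : Nonempty s := ⟨⟨v, hcon⟩⟩
    refine SimpleGraph.Connected.mk fun ⟨x, hx⟩ ⟨y, hy⟩ => ?_
    obtain ⟨p, hp⟩ := hT.connected.exists_walk_length_eq_dist x y
    refine ⟨p.induce s fun z hz g => ?_⟩
    have h1 := dist_add_dist_of_mem_support hT.connected hp hz
    have hx' := hx g
    have hy' := hy g
    rw [← Set.mem_compl_iff, compl_halfTree hT hab] at hx' hy' ⊢
    refine mem_halfTree_of_between hT hab.symm hx' hy' ?_
    simpa only [dist_map hT.connected] using h1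
  have htree : IsSubtree ((⊤ : T.Subgraph).induce s) := by
    rw [IsSubtree, ← SimpleGraph.induce_eq_coe_induce_top]
    exact ⟨hconn, hT.isAcyclic.induce s⟩
  have hs' : ∀ (g : Γ) (x : V), ρ g x ∈ s ↔ x ∈ s := by
    intro g x
    constructor
    · intro h k
      have := h (k * g⁻¹)
      rwa [← RelIso.mul_apply, ← map_mul, inv_mul_cancel_right] at this
    · intro h k
      have := h (k * g)
      rwa [map_mul, RelIso.mul_apply] at this
  have hinv : ∀ g : Γ, ((⊤ : T.Subgraph).induce s).map (ρ g).toHom = (⊤ : T.Subgraph).induce s := by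
    intro g
    ext x y
    · constructor
      · rintro ⟨z, hz, rfl⟩
        exact (hs' g z).2 hz
      · intro hx
        refine ⟨(ρ g).symm x, ?_, (ρ g).apply_symm_apply x⟩
        exact (hs' g _).1 (by rwa [(ρ g).apply_symm_apply])
    · constructor
      · rintro ⟨z, w, ⟨hz, hw, hzw⟩, rfl, rfl⟩
        exact ⟨(hs' g z).2 hz, (hs' g w).2 hw, (ρ g).map_adj_iff.2 hzw⟩
      · rintro ⟨hx, hy, hxy⟩
        refine ⟨(ρ g).symm x, (ρ g).symm y, ⟨?_, ?_, (ρ g).symm.map_adj_iff.2 hxy⟩,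
          (ρ g).apply_symm_apply x, (ρ g).apply_symm_apply y⟩
        · exact (hs' g _).1 (by rwa [(ρ g).apply_symm_apply])
        · exact (hs' g _).1 (by rwa [(ρ g).apply_symm_apply])
  have htop := hmin _ htree hinv
  have hb : b ∈ ((⊤ : T.Subgraph).induce s).verts := by
    rw [htop]
    trivial
  exact hb 1 (by simpa using right_mem_halfTree hab)

/-- The class of the positive ray of a line is fixed by the automorphisms translating the line. -/
theorem boundaryMap_mk_line (hT : T.IsTree) {φ : T ≃g T} {ℓ : ℤ → V} (hℓ : IsGeodesicLine T ℓ)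
    {n : ℤ} (hφ : ∀ k, φ (ℓ k) = ℓ (k + n)) :
    boundaryMap hT φ (Quotient.mk _ ⟨fun i : ℕ => ℓ i, hℓ.isGeodesicRay⟩) =
      Quotient.mk _ ⟨fun i : ℕ => ℓ i, hℓ.isGeodesicRay⟩ := by
  refine Quotient.sound ?_
  change (symmDiff (Set.range fun i : ℕ => φ (ℓ i)) (Set.range fun i : ℕ => ℓ i)).Finite
  have hfin : ((fun k : ℤ => ℓ k) '' Set.Icc (-|n|) |n|).Finite := (Set.finite_Icc _ _).image _
  refine hfin.subset ?_
  rintro x (⟨⟨i, rfl⟩, hx⟩ | ⟨⟨i, rfl⟩, hx⟩)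
  · refine ⟨i + n, ⟨?_, ?_⟩, (hφ i).symm⟩
    · have := neg_abs_le n
      omega
    · by_contra hcon
      refine hx ⟨(i + n).toNat, ?_⟩
      have := abs_nonneg n
      simp only [hφ]
      congr 1
      omega
  · refine ⟨i, ⟨?_, ?_⟩, rfl⟩
    · have := abs_nonneg n
      omega
    · by_contra hcon
      refine hx ⟨(i - n).toNat, ?_⟩
      have := le_abs_self n
      simp only [hφ]
      congr 1
      omega

/-- The positive ends of two axes are fixed points, hence distinct if there is no common fixed point,
and then they have disjoint neighbourhoods. -/
theorem exists_disjoint_lineHalfTree (hT : T.IsTree) {φ ψ : T ≃g T}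
    (h : ∀ ξ : Boundary T, ¬ (boundaryMap hT φ ξ = ξ ∧ boundaryMap hT ψ ξ = ξ))
    {ℓ ℓ' : ℤ → V} (hℓ : IsGeodesicLine T ℓ) (hℓ' : IsGeodesicLine T ℓ') {n m : ℤ}
    (hφ : ∀ k, φ (ℓ k) = ℓ (k + n)) (hψ : ∀ k, ψ (ℓ' k) = ℓ' (k + m)) :
    ∃ i, Disjoint (lineHalfTree T ℓ i) (lineHalfTree T ℓ' i) := by
  by_contra! hcon
  refine h _ ⟨boundaryMap_mk_line hT hℓ hφ, ?_⟩
  have heq : (Quotient.mk (raySetoid T) ⟨fun i : ℕ => ℓ i, hℓ.isGeodesicRay⟩ : Boundary T) =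
      Quotient.mk _ ⟨fun i : ℕ => ℓ' i, hℓ'.isGeodesicRay⟩ := by
    refine Quotient.sound ?_
    exact (finite_range_diff_range hT hℓ hℓ' hcon).union
      (finite_range_diff_range hT hℓ' hℓ fun i hd => hcon i hd.symm)
  rw [heq]
  exact boundaryMap_mk_line hT hℓ' hψ

/-- The intersection of the conjugates of the stabilizer of `B` by the stabilizer of `u` is the
pointwise stabilizer of a union of translates of `B`, which is contained in a ball around `u`. -/
theorem exists_ball_fixator_trivial (hT : T.IsTree) {ρ : Γ →* (T ≃g T)} {B : T.Subgraph}
    (hB : IsBounded B) {u : V} (hu : u ∈ B.verts)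
    (hcore : IsCoreFreeIn (pointwiseStabilizer ρ B) (vertexStabilizer ρ u)) :
    ∃ N : ℕ, ∀ c : Γ, (∀ v, T.dist u v ≤ N → ρ c v = v) → c = 1 := by
  obtain ⟨N, hN⟩ := hB
  refine ⟨N, fun c hc => ?_⟩
  have hcu : c ∈ vertexStabilizer ρ u := hc u (by simp)
  have hmem : (⟨c, hcu⟩ : vertexStabilizer ρ u) ∈
      ((pointwiseStabilizer ρ B).subgroupOf (vertexStabilizer ρ u)).normalCore := by
    rintro ⟨k, hk⟩
    rw [Subgroup.mem_subgroupOf]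
    change ρ (k * c * k⁻¹) ∈ fixingSubgroup (T ≃g T) B.verts
    rw [mem_fixingSubgroup_iff]
    intro v hv
    have hk' : ρ k⁻¹ u = u := (vertexStabilizer ρ u).inv_mem hk
    have h1 : ρ c (ρ k⁻¹ v) = ρ k⁻¹ v := by
      refine hc _ ?_
      rw [← hk', dist_map hT.connected]
      simpa [hk'] using hN u hu v hv
    change ρ (k * c * k⁻¹) v = v
    rw [map_mul, map_mul, RelIso.mul_apply, RelIso.mul_apply, h1, ← RelIso.mul_apply, ← map_mul]
    simp
  rw [hcore.2, Subgroup.mem_bot] at hmem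
  exact congrArg Subtype.val hmem

end Automorphisms

end TreeAction

theorem corollaryF (Γ : Type*) [Group Γ] [Countable Γ]
    (V : Type*) (T : SimpleGraph V) (hT : T.IsTree) (ρ : Γ →* (T ≃g T))
    (hfaithful : Function.Injective ρ)
    (hminimal : TreeAction.IsMinimal ρ)
    (hgeneral : TreeAction.IsGeneralType hT ρ)
    (hcore : ∃ B : T.Subgraph, TreeAction.IsSubtree B ∧ TreeAction.IsBounded B ∧
      ∃ u ∈ B.verts, TreeAction.IsCoreFreeIn
        (TreeAction.pointwiseStabilizer ρ B) (TreeAction.vertexStabilizer ρ u)) :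
    (∃ (X : Type) (_ : Countable X) (_ : Infinite X) (_ : MulAction Γ X),
      TreeAction.IsHighlyTransitiveAction Γ X ∧ TreeAction.IsHighlyFaithfulAction Γ X) ∧
    TreeAction.IsHighlyTransitiveGroup Γ := by
  obtain ⟨B, -, hB, u, hu, hcf⟩ := hcore
  obtain ⟨N, hN⟩ := TreeAction.exists_ball_fixator_trivial hT hB hu hcf
  obtain ⟨g, h, ⟨ℓ, hℓ, n, hn, hgℓ⟩, ⟨ℓ', hℓ', m, hm, hhℓ⟩, hends⟩ := hgeneral
  let act : MulAction Γ V := MulAction.compHom V ρ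
  have hΓ : TreeAction.IsIsometricAction Γ T :=
    ⟨fun k x y => TreeAction.dist_map hT.connected (ρ k) x y⟩
  have hg : TreeAction.IsAxis T g ℓ n := ⟨hℓ, hn, hgℓ⟩
  have hh : TreeAction.IsAxis T h ℓ' m := ⟨hℓ', hm, hhℓ⟩
  have h𝓗 : TreeAction.IsHalfspaceSystem Γ (TreeAction.halfTrees T) := by
    refine TreeAction.isHalfspaceSystem_halfTrees hT hΓ
      (fun A hA v => hminimal.exists_apply_mem_halfTree hT hA v) hg hh ?_ ⟨u, N, hN⟩
    rintro L L' (rfl | rfl) (rfl | rfl)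
    · exact TreeAction.exists_disjoint_lineHalfTree hT hends hℓ hℓ' hgℓ hhℓ
    · exact TreeAction.exists_disjoint_lineHalfTree hT hends hℓ hℓ'.reverse hgℓ hh.reverse.smul_eq
    · exact TreeAction.exists_disjoint_lineHalfTree hT hends hℓ.reverse hℓ' hg.reverse.smul_eq hhℓ
    · exact TreeAction.exists_disjoint_lineHalfTree hT hends hℓ.reverse hℓ'.reverse
        hg.reverse.smul_eq hh.reverse.smul_eq
  obtain ⟨X, hX, hX', hact, htrans, hfaith⟩ := h𝓗.exists_action
  exact ⟨⟨X, hX, hX', hact, htrans, hfaith⟩, X, hX, hX', hact, hfaith.faithfulSMul, htrans⟩
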